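/- Let $\mathcal L'$ be a first-order language and let $\mathcal I$ be an infinite $\mathcal L'$-structure that is locally finite (every finitely generated substructure is finite). Let $\mathrm{age}(\mathcal I)$ be the class of finitely generated $\mathcal L'$-structures that embed into $\mathcal I$. Then the following are equivalent. 1. $\mathrm{age}(\mathcal I)$ has the embedding Ramsey property: for all $A\subseteq B$ in $\mathrm{age}(\mathcal I)$ and all $r<\omega$ there is $C\in\mathrm{age}(\mathcal I)$ such that for every coloring $\chi$, with $r$ colors, of the embeddings of $A$ into $C$ there is an embedding $f\colon B\to C$ for which $\chi$ takes the same value on all the maps $f\circ g$, where $g$ ranges over the embeddings of $A$ into $B$. 2. $\mathcal I$-indexed indiscernibles have the continuous modeling property: for every continuous signature $\mathcal L$, every continuous $\mathcal L$-theory $T$ and every monster model $\mathfrak C$ of $T$, every sequence $(a_i)_{i\in\mathcal I}$ of elements of $\mathfrak C$ admits an $\mathcal I$-indiscernible sequence $(b_i)_{i\in\mathcal I}$ in $\mathfrak C$ that is locally based on $(a_i)_{i\in\mathcal I}$. Here structures for continuous logic are nonempty complete metric spaces of diameter at most $1$, whose function symbols and $[0,1]$-valued predicate symbols are uniformly continuous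 with the moduli prescribed by the signature; the connectives are all continuous functions $[0,1]^k\to[0,1]$ and the quantifiers are $\sup$ and $\inf$. A monster model of $T$ is a model of $T$ that is $\kappa$-saturated and strongly $\kappa$-homogeneous for some strong limit cardinal $\kappa$ with $\kappa>|T|$ and $\kappa>|\mathcal I|$, where $|T|$ denotes the number of $\mathcal L$-formulas. Write $\mathrm{qftp}$ for the quantifier-free $\mathcal L'$-type in $\mathcal I$ and $\mathrm{tp}$ for the complete $\mathcal L$-type over $\emptyset$ in $\mathfrak C$. The sequence $(b_i)_{i\in\mathcal I}$ is $\mathcal I$-indiscernible if, for all $n<\omega$ and all $n$-tuples $\bar\imath,\bar\jmath$ from $\mathcal I$, $\mathrm{qftp}(\bar\imath)=\mathrm{qftp}(\bar\jmath)$ implies $\mathrm{tp}(b_{i_1},\dots,b_{i_n})=\mathrm{tp}(b_{j_1},\dots,b_{j_n})$. It is locally based on $(a_i)_{i\in\mathcal I}$ if for every finite set $\Delta$ of $\mathcal L$-formulas, every finite tuple $\bar\jmath$ from $\mathcal I$ and every $\varepsilon>0$ there is a tuple $\bar\imath$ from $\mathcal I$ with $\mathrm{qftp}(\bar\imath)=\mathrm{qftp}(\bar\jmath)$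 and $|\varphi(b_{\bar\jmath})-\varphi(a_{\bar\imath})|\le\varepsilon$ for all $\varphi\in\Delta$. -/

import Mathlib

universe s t u v w x

open Cardinal

/-! ### Continuous logic -/

/-- A one-sorted continuous (metric) signature. The distance symbol `d` is always present and is
therefore not listed among the predicate symbols; it is interpreted by the metric. A uniform
continuity modulus is a function from positive reals to positive reals. -/
structure MetricSignature where
  Functions : ℕ → Type s
  Predicates : ℕ → Type t
  funModulus : ∀ {n : ℕ}, Functions n → Fin n → Set.Ioi (0 : ℝ) → Set.Ioi (0 : ℝ)
  predModulus : ∀ {n : ℕ}, Predicates n → Fin n → Set.Ioi (0 : ℝ) → Set.Ioi (0 : ℝ)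

namespace MetricSignature

/-- Terms whose variables are among `x_0, …, x_{n-1}`. -/
inductive Term (S : MetricSignature.{s, t}) (n : ℕ) : Type s
  | var (i : Fin n) : Term S n
  | func {k : ℕ} (f : S.Functions k) (ts : Fin k → Term S n) : Term S n

/-- Continuous formulas whose free variables are among `x_0, …, x_{n-1}`. The connectives are all
continuous (equivalently, uniformly continuous) functions `[0,1]^k → [0,1]`; the quantifiers
`sup` and `inf` bind the last variable. -/
inductive Formula (S : MetricSignature.{s, t}) : ℕ → Type (max s t)
  | dist {n : ℕ} (t₁ t₂ : S.Term n) : Formula S n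
  | pred {n k : ℕ} (P : S.Predicates k) (ts : Fin k → S.Term n) : Formula S n
  | conn {n k : ℕ} (c : C(Fin k → unitInterval, unitInterval)) (φs : Fin k → Formula S n) :
      Formula S n
  | sup {n : ℕ} (φ : Formula S (n + 1)) : Formula S n
  | inf {n : ℕ} (φ : Formula S (n + 1)) : Formula S n

/-- Sentences. A sentence `φ`, as a member of a theory, stands for the condition `φ = 0`. -/
abbrev Sentence (S : MetricSignature.{s, t}) : Type (max s t) := S.Formula 0

/-- An `S`-structure: a nonempty complete metric space of diameter at most `1`, with
interpretations of the symbols that respect the uniform continuity moduli in each argument. -/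
class Structure (S : MetricSignature.{s, t}) (M : Type x) [MetricSpace M] where
  nonempty : Nonempty M
  complete : CompleteSpace M
  dist_le_one : ∀ a b : M, Dist.dist a b ≤ 1
  funMap : ∀ {n : ℕ}, S.Functions n → (Fin n → M) → M
  predMap : ∀ {n : ℕ}, S.Predicates n → (Fin n → M) → unitInterval
  funMap_modulus : ∀ {n : ℕ} (f : S.Functions n) (i : Fin n) (ε : Set.Ioi (0 : ℝ))
    (a : Fin n → M) (b c : M), Dist.dist b c < S.funModulus f i ε →
      Dist.dist (funMap f (Function.update a i b)) (funMap f (Function.update a i c)) ≤ ε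
  predMap_modulus : ∀ {n : ℕ} (P : S.Predicates n) (i : Fin n) (ε : Set.Ioi (0 : ℝ))
    (a : Fin n → M) (b c : M), Dist.dist b c < S.predModulus P i ε →
      Dist.dist (predMap P (Function.update a i b)) (predMap P (Function.update a i c)) ≤ ε

variable {S : MetricSignature.{s, t}} {M : Type x} [MetricSpace M] [S.Structure M]

/-- The value of a term at a tuple. -/
def Term.eval {n : ℕ} (a : Fin n → M) : S.Term n → M
  | .var i => a i
  | .func f ts => Structure.funMap f (fun i => (ts i).eval a)

/-- The value in `[0,1]` of a formula at a tuple. -/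
noncomputable def Formula.eval : {n : ℕ} → S.Formula n → (Fin n → M) → unitInterval
  | _, .dist t₁ t₂, a =>
      ⟨Dist.dist (t₁.eval a) (t₂.eval a), dist_nonneg, Structure.dist_le_one S _ _⟩
  | _, .pred P ts, a => Structure.predMap P (fun i => (ts i).eval a)
  | _, .conn c φs, a => c (fun i => (φs i).eval a)
  | _, .sup φ, a => ⨆ m : M, φ.eval (Fin.snoc (α := fun _ => M) a m)
  | _, .inf φ, a => ⨅ m : M, φ.eval (Fin.snoc (α := fun _ => M) a m)

variable (S) in
/-- Two `n`-tuples have the same complete type over the empty set. -/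
def SameType {n : ℕ} (a b : Fin n → M) : Prop :=
  ∀ φ : S.Formula n, φ.eval a = φ.eval b

variable (M) in
/-- `M` is a model of the set `T` of conditions `φ = 0`. -/
def IsModel (T : Set S.Sentence) : Prop :=
  ∀ φ ∈ T, φ.eval (default : Fin 0 → M) = 0

/-- A condition `φ(p, y) = 0` in the single variable `y`, with parameters `p` from `A`. -/
structure Cond (S : MetricSignature.{s, t}) {M : Type x} (A : Set M) where
  n : ℕ
  formula : S.Formula (n + 1)
  params : Fin n → A

/-- The value of (the formula of) a one-variable condition over `A` at an element. -/
noncomputable def Cond.eval {A : Set M} (c : S.Cond A) (m : M) : unitInterval :=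
  c.formula.eval (Fin.snoc (α := fun _ => M) (fun i => (c.params i : M)) m)

variable (S M) in
/-- `κ`-saturation: over every set of fewer than `κ` parameters, every set of conditions in one
variable which is finitely satisfiable up to arbitrarily small errors (equivalently, consistent
with the theory of `M` with these parameters named) is realized. -/
def IsSaturated (κ : Cardinal.{x}) : Prop :=
  ∀ A : Set M, #A < κ → ∀ Γ : Set (S.Cond A),
    (∀ Γ₀ : Set (S.Cond A), Γ₀ ⊆ Γ → Γ₀.Finite → ∀ ε : ℝ, 0 < ε →
      ∃ m : M, ∀ c ∈ Γ₀, (c.eval m : ℝ) ≤ ε) →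
    ∃ m : M, ∀ c ∈ Γ, c.eval m = 0

variable (S) in
/-- A bijection of `M` onto itself is an automorphism. -/
structure IsAutomorphism (σ : M ≃ M) : Prop where
  dist_eq : ∀ a b : M, Dist.dist (σ a) (σ b) = Dist.dist a b
  map_fun : ∀ {n : ℕ} (f : S.Functions n) (a : Fin n → M),
    σ (Structure.funMap f a) = Structure.funMap f (fun i => σ (a i))
  map_pred : ∀ {n : ℕ} (P : S.Predicates n) (a : Fin n → M),
    Structure.predMap P (fun i => σ (a i)) = Structure.predMap P a

variable (S M) in
/-- Strong `κ`-homogeneity: every elementary map between subsets of `M` whose domain has fewer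
than `κ` elements extends to an automorphism. -/
def IsStronglyHomogeneous (κ : Cardinal.{x}) : Prop :=
  ∀ A : Set M, #A < κ → ∀ f : A → M,
    (∀ (n : ℕ) (p : Fin n → A), S.SameType (fun i => (p i : M)) (fun i => f (p i))) →
    ∃ σ : M ≃ M, S.IsAutomorphism σ ∧ ∀ a : A, σ a = f a

variable (M) in
/-- `M` is a monster model of `T` with respect to `κ`: a model of `T` which is `κ`-saturated and
strongly `κ`-homogeneous, where `κ` is a strong limit cardinal greater than `|T|`, the number of
formulas of the language. -/
structure IsMonster (T : Set S.Sentence) (κ : Cardinal.{x}) : Prop where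
  isModel : IsModel M T
  isStrongLimit : κ.IsStrongLimit
  card_lt : Cardinal.lift.{x} #(Σ n : ℕ, S.Formula n) < Cardinal.lift.{max s t} κ
  isSaturated : IsSaturated S M κ
  isStronglyHomogeneous : IsStronglyHomogeneous S M κ

end MetricSignature

/-! ### Generalized indiscernibles -/

namespace FirstOrder.Language

/-- `qftp(i_1, …, i_n) = qftp(j_1, …, j_n)`, for tuples from two structures. -/
def SameQFType (L : FirstOrder.Language.{u, v}) {I : Type w} {J : Type x}
    [L.Structure I] [L.Structure J] {n : ℕ} (i : Fin n → I) (j : Fin n → J) : Prop :=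
  ∀ φ : L.Formula (Fin n), φ.IsQF → (φ.Realize i ↔ φ.Realize j)

/-- `I`-indexed indiscernible sequences (over the empty set). -/
def IsIndiscernible (L : FirstOrder.Language.{u, v}) {I : Type w} [L.Structure I]
    (S : MetricSignature.{s, t}) {M : Type x} [MetricSpace M] [S.Structure M]
    (a : I → M) : Prop :=
  ∀ (n : ℕ) (i j : Fin n → I), L.SameQFType i j →
    S.SameType (fun k => a (i k)) (fun k => a (j k))

/-- The `J`-indexed sequence `b` is locally based on the `I`-indexed sequence `a`. -/
def IsLocallyBasedOn (L : FirstOrder.Language.{u, v}) {I J : Type w} [L.Structure I]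
    [L.Structure J] (S : MetricSignature.{s, t}) {M : Type x} [MetricSpace M] [S.Structure M]
    (b : J → M) (a : I → M) : Prop :=
  ∀ (n : ℕ) (Δ : Set (S.Formula n)), Δ.Finite → ∀ (j : Fin n → J) (ε : ℝ), 0 < ε →
    ∃ i : Fin n → I, L.SameQFType i j ∧
      ∀ φ ∈ Δ, |(φ.eval (fun k => b (j k)) : ℝ) - (φ.eval (fun k => a (i k)) : ℝ)| ≤ ε

/-- `I`-indexed indiscernibles have the continuous modeling property in `T`. The monster models
are those for which the index structure is small, that is, `|I| < κ`. -/
def HasCMPIn (L : FirstOrder.Language.{u, v}) (I : Type w) [L.Structure I]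
    {S : MetricSignature.{s, t}} (T : Set S.Sentence) : Prop :=
  ∀ (M : Type (max s t w)) [MetricSpace M] [S.Structure M] (κ : Cardinal.{max s t w}),
    MetricSignature.IsMonster M T κ → Cardinal.lift.{max s t} #I < κ →
    ∀ a : I → M, ∃ b : I → M, L.IsIndiscernible S b ∧ L.IsLocallyBasedOn S b a

/-- `I` has the continuous modeling property: `I`-indexed indiscernibles have the continuous
modeling property in every continuous theory. -/
def HasCMP (L : FirstOrder.Language.{u, v}) (I : Type w) [L.Structure I] : Prop :=
  ∀ (S : MetricSignature.{s, t}) (T : Set S.Sentence), HasCMPIn.{s, t, u, v, w} L I T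

/-! ### The embedding Ramsey property -/

/-- `C → (B)^A_r`: every coloring of the embeddings of `A` into `C` with `r` colors is constant
on `f ∘ (B choose A)` for some embedding `f` of `B` into `C`. -/
def RamseyArrow (L : FirstOrder.Language.{u, v}) (C B A : Type w) [L.Structure C]
    [L.Structure B] [L.Structure A] (r : ℕ) : Prop :=
  ∀ χ : (A ↪[L] C) → Fin r, ∃ f : B ↪[L] C, ∀ g h : A ↪[L] B, χ (f.comp g) = χ (f.comp h)

/-- The embedding Ramsey property of a class of structures. -/
def HasERP {L : FirstOrder.Language.{u, v}}
    (K : Set (CategoryTheory.Bundled.{w} L.Structure)) : Prop :=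
  ∀ B ∈ K, ∀ A : L.Substructure B, CategoryTheory.Bundled.of (c := L.Structure) A ∈ K →
    ∀ r : ℕ, ∃ C ∈ K, L.RamseyArrow C B A r

/-- Every finitely generated substructure of `I` is finite. -/
def IsLocallyFinite (L : FirstOrder.Language.{u, v}) (I : Type w) [L.Structure I] : Prop :=
  ∀ A : L.Substructure I, A.FG → Finite A

end FirstOrder.Language

/-!
The two properties are linked by compactness, in the form of saturation.

From the Ramsey property to indiscernibles: being indiscernible and being locally based on `a` are
expressed by a set of conditions on variables `x_i`, `i ∈ I`. Only finitely many conditions have to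
be satisfied at a time, and only up to an error `ε`, by a saturated structure; these involve a
finite substructure `B` of `I`, and an assignment `x_i = a_{f(i)}` given by an embedding
`f : B → I` does it as soon as finitely many colorings, by rounded values of formulas, of embeddings
of substructures of `B` are constant on those which factor through `f`. Such an `f` is provided by
iterating the Ramsey property (`FirstOrder.Language.HasERP.exists_isConstantOn`). That saturation in
one variable implies saturation in fewer than `κ` variables is
`MetricSignature.IsSaturated.exists_realization`.

From indiscernibles to the Ramsey property: if the Ramsey property fails for `A` and `B`, then by
compactness there is a coloring of the embeddings of `A` into `I` which is not constant on the
embeddings that factor through any given embedding of `B`. In a monster model of the generic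
coloring of `n`-tuples, `n = |A|`, this coloring is realized by a sequence `a`. An indiscernible
sequence `b` locally based on `a` gives all copies of `A` inside a copy of `B` the same color, and
this is inherited by some copy of `B` in `I`, contradicting the choice of the coloring.

What remains is to find a monster model (`GenericModel.exists_isMonster`). Let `Z` consist of the
pairs of a natural number and an automorphism of the countable generic coloring, which is
homogeneous. By Zorn's lemma there are a set `X` of names and an ultrafilter on `X → Z` modulo which
every finitely satisfiable set of conditions on `Z`, with parameters from a family of names of
bounded size, is realized by a name (`GenericModel.exists_saturated_ultrafilter`). The model
consists of the names modulo equality of the numbers they stand for. Strong homogeneity follows from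
saturation: an isomorphism between small subsets is approximated by automorphisms of the countable
generic coloring, hence is induced by an automorphism which has a name. No cardinal arithmetic is
needed, since nothing is assumed about the size of the model.
-/

/-! ### Substitution of variables and repeated infima -/

namespace MetricSignature

variable {S : MetricSignature.{s, t}}

/-- Substitution of the variable `x_{f i}` for `x_i` in a term. -/
def Term.rename {n m : ℕ} (f : Fin n → Fin m) : S.Term n → S.Term m
  | .var i => .var (f i)
  | .func g ts => .func g (fun i => (ts i).rename f)

/-- The extension of a substitution of variables which keeps the last (bound) variable. -/
def liftRename {n m : ℕ} (f : Fin n → Fin m) : Fin (n + 1) → Fin (m + 1) :=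
  Fin.snoc (α := fun _ => Fin (m + 1)) (fun i => (f i).castSucc) (Fin.last m)

/-- Substitution of the free variable `x_{f i}` for `x_i` in a formula. -/
def Formula.rename : {n m : ℕ} → (Fin n → Fin m) → S.Formula n → S.Formula m
  | _, _, f, .dist t₁ t₂ => .dist (t₁.rename f) (t₂.rename f)
  | _, _, f, .pred P ts => .pred P (fun i => (ts i).rename f)
  | _, _, f, .conn c φs => .conn c (fun i => (φs i).rename f)
  | _, _, f, .sup φ => .sup (φ.rename (liftRename f))
  | _, _, f, .inf φ => .inf (φ.rename (liftRename f))

/-- The infimum over the last `k` variables. -/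
def Formula.iterInf {n : ℕ} : (k : ℕ) → S.Formula (n + k) → S.Formula n
  | 0, φ => φ
  | k + 1, φ => Formula.iterInf k (.inf φ)

theorem snoc_liftRename {M : Type x} {n m : ℕ} (f : Fin n → Fin m) (a : Fin m → M) (b : M) :
    (fun i => Fin.snoc (α := fun _ => M) a b (liftRename f i)) =
      Fin.snoc (α := fun _ => M) (fun i => a (f i)) b := by
  funext i
  refine Fin.lastCases ?_ (fun i => ?_) i <;> simp [liftRename]

variable {M : Type x} [MetricSpace M] [S.Structure M]

theorem Term.eval_rename {n m : ℕ} (f : Fin n → Fin m) (t : S.Term n) (a : Fin m → M) :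
    (t.rename f).eval a = t.eval (fun i => a (f i)) := by
  induction t with
  | var i => rfl
  | func g ts ih => simp only [Term.rename, Term.eval, ih]

theorem Formula.eval_rename {n : ℕ} (φ : S.Formula n) :
    ∀ {m : ℕ} (f : Fin n → Fin m) (a : Fin m → M),
      (φ.rename f).eval a = φ.eval (fun i => a (f i)) := by
  induction φ with
  | dist t₁ t₂ => intro m f a; simp only [Formula.rename, Formula.eval, Term.eval_rename]
  | pred P ts => intro m f a; simp only [Formula.rename, Formula.eval, Term.eval_rename]
  | conn c φs ih => intro m f a; simp only [Formula.rename, Formula.eval, ih]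
  | sup φ ih => intro m f a; simp only [Formula.rename, Formula.eval, ih, snoc_liftRename]
  | inf φ ih => intro m f a; simp only [Formula.rename, Formula.eval, ih, snoc_liftRename]

theorem Formula.eval_iterInf_le {n : ℕ} : ∀ (k : ℕ) (φ : S.Formula (n + k)) (z : Fin (n + k) → M),
    (φ.iterInf k).eval (fun q => z (Fin.castAdd k q)) ≤ φ.eval z
  | 0, _, _ => le_rfl
  | k + 1, φ, z => by
    refine (Formula.eval_iterInf_le k (.inf φ) (fun q => z q.castSucc)).trans ?_
    refine (iInf_le _ (z (Fin.last (n + k)))).trans (le_of_eq ?_)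
    exact congrArg _ (Fin.snoc_init_self (α := fun _ => M) z)

theorem Formula.exists_of_eval_iterInf_lt {n : ℕ} : ∀ (k : ℕ) (φ : S.Formula (n + k))
    (a : Fin n → M) (r : unitInterval), (φ.iterInf k).eval a < r →
    ∃ z : Fin (n + k) → M, (∀ q, z (Fin.castAdd k q) = a q) ∧ φ.eval z < r
  | 0, _, a, _, h => ⟨a, fun _ => rfl, h⟩
  | k + 1, φ, a, r, h => by
    obtain ⟨z, hz, hr⟩ := Formula.exists_of_eval_iterInf_lt k (.inf φ) a r h
    obtain ⟨m, hm⟩ := iInf_lt_iff.1 hr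
    refine ⟨Fin.snoc (α := fun _ => M) z m, fun q => ?_, hm⟩
    rw [← hz q]
    exact Fin.snoc_castSucc (α := fun _ => M) m z (Fin.castAdd k q)

/-- The pointwise maximum, as a connective. -/
def maxConn (k : ℕ) : C(Fin k → unitInterval, unitInterval) where
  toFun v := Finset.univ.sup v
  continuous_toFun := Continuous.finset_sup_apply fun i _ => continuous_apply i

theorem maxConn_le_iff {k : ℕ} (v : Fin k → unitInterval) (r : unitInterval) :
    maxConn k v ≤ r ↔ ∀ i, v i ≤ r := by
  simp [maxConn, Finset.sup_le_iff]

/-! ### Realizing conditions in many variables -/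

/-- A condition `φ(x_{j_1}, …, x_{j_n}) = 0` in variables indexed by `I`. -/
structure VarCond (S : MetricSignature.{s, t}) (I : Type w) where
  n : ℕ
  formula : S.Formula n
  idx : Fin n → I

/-- The value of (the formula of) a condition at an assignment of the variables. -/
noncomputable def VarCond.eval {I : Type w} (c : S.VarCond I) (y : I → M) : unitInterval :=
  c.formula.eval (fun k => y (c.idx k))

/-- Projecting finitely many conditions to the variable `i`: the variables in `J` are replaced by
their values under `y₀`, and all others except `i` are bound by infima. -/
theorem exists_cond_of_finite {I : Type w} (J : Set I) (y₀ : I → M) (i : I) (hi : i ∉ J)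
    (Γ₀ : Set (S.VarCond I)) (hfin : Γ₀.Finite) :
    ∃ c₀ : S.Cond (y₀ '' J),
      (∀ y : I → M, Set.EqOn y y₀ J → ∀ ε : ℝ, 0 < ε → (∀ c ∈ Γ₀, (c.eval y : ℝ) ≤ ε) →
        (c₀.eval (y i) : ℝ) ≤ ε) ∧
      (∀ (m : M) (ε : ℝ), 0 < ε → c₀.eval m = 0 → ∃ y : I → M, Set.EqOn y y₀ J ∧ y i = m ∧
        ∀ c ∈ Γ₀, (c.eval y : ℝ) ≤ ε) := by
  classical
  have hF : (⋃ c ∈ Γ₀, Set.range c.idx).Finite := hfin.biUnion fun c _ => Set.finite_range _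
  set F : Finset I := hF.toFinset with hFdef
  have hmem : ∀ c ∈ Γ₀, ∀ k, c.idx k ∈ F := by
    intro c hc k
    rw [hFdef, Set.Finite.mem_toFinset]
    exact Set.mem_biUnion hc ⟨k, rfl⟩
  let F₁ : Finset I := F.filter (· ∈ J)
  let F₂ : Finset I := F.filter (fun l => l ∉ J ∧ l ≠ i)
  let e₁ := F₁.equivFin
  let e₂ := F₂.equivFin
  let n := F₁.card
  let k := F₂.card
  -- The variables are ordered as follows: the parameters, the variable `i`, the bound variables.
  let ix : I → Fin (n + 1 + k) := fun l =>
    if h : l ∈ F₁ then Fin.castAdd k (e₁ ⟨l, h⟩).castSucc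
    else if h : l ∈ F₂ then Fin.natAdd (n + 1) (e₂ ⟨l, h⟩)
    else Fin.castAdd k (Fin.last n)
  have hJ : ∀ l (h : l ∈ F₁), l ∈ J := fun l h => (Finset.mem_filter.1 h).2
  have hiF₁ : i ∉ F₁ := fun h => hi (hJ i h)
  have hiF₂ : i ∉ F₂ := fun h => (Finset.mem_filter.1 h).2.2 rfl
  have hixi : ix i = Fin.castAdd k (Fin.last n) := by
    simp only [ix, hiF₁, hiF₂, dif_neg, not_false_iff]
  let e₀ := hfin.toFinset.equivFin
  let N := hfin.toFinset.card
  let φ : S.Formula (n + 1 + k) :=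
    .conn (maxConn N) (fun q => (e₀.symm q).1.formula.rename (fun l => ix ((e₀.symm q).1.idx l)))
  have hφ : ∀ (z : Fin (n + 1 + k) → M) (r : unitInterval),
      φ.eval z ≤ r ↔ ∀ c ∈ Γ₀, c.eval (fun l => z (ix l)) ≤ r := by
    intro z r
    simp only [φ, Formula.eval, maxConn_le_iff, Formula.eval_rename]
    constructor
    · intro h c hc
      have := h (e₀ ⟨c, hfin.mem_toFinset.2 hc⟩)
      rw [Equiv.symm_apply_apply] at this
      exact this
    · intro h q
      exact h _ (hfin.mem_toFinset.1 (e₀.symm q).2)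
  let p : Fin n → ↥(y₀ '' J) := fun q => ⟨y₀ (e₁.symm q).1, ⟨_, hJ _ (e₁.symm q).2, rfl⟩⟩
  refine ⟨⟨n, φ.iterInf k, p⟩, ?_, ?_⟩
  · intro y hy ε hε hc
    have hz : ∃ z : Fin (n + 1 + k) → M,
        (∀ q, z (Fin.castAdd k q) =
          Fin.snoc (α := fun _ => M) (fun q => (p q : M)) (y i) q) ∧
        ∀ l ∈ F, z (ix l) = y l := by
      refine ⟨Fin.append (Fin.snoc (α := fun _ => M) (fun q => (p q : M)) (y i))
        (fun q => y (e₂.symm q).1), fun q => Fin.append_left _ _ _, fun l hl => ?_⟩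
      by_cases h₁ : l ∈ F₁
      · have : ix l = Fin.castAdd k (e₁ ⟨l, h₁⟩).castSucc := by simp only [ix, dif_pos h₁]
        rw [this, Fin.append_left, Fin.snoc_castSucc]
        simp only [p, Equiv.symm_apply_apply]
        exact (hy (hJ l h₁)).symm
      · by_cases h₂ : l ∈ F₂
        · have : ix l = Fin.natAdd (n + 1) (e₂ ⟨l, h₂⟩) := by
            simp only [ix, dif_neg h₁, dif_pos h₂]
          rw [this, Fin.append_right, Equiv.symm_apply_apply]
        · have hli : l = i := by
            by_contra hne
            refine h₂ (Finset.mem_filter.2 ⟨hl, fun hlJ => h₁ (Finset.mem_filter.2 ⟨hl, hlJ⟩), hne⟩)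
          rw [hli, hixi, Fin.append_left, Fin.snoc_last]
    obtain ⟨z, hz, hzF⟩ := hz
    have h := Formula.eval_iterInf_le k φ z
    rw [funext hz] at h
    refine (Subtype.coe_le_coe.2 h).trans ?_
    by_cases hε1 : ε ≤ 1
    · refine Subtype.coe_le_coe.2 ((hφ z ⟨ε, hε.le, hε1⟩).2 fun c hcΓ => ?_)
      have : c.eval (fun l => z (ix l)) = c.eval y :=
        congrArg c.formula.eval (funext fun q => hzF _ (hmem c hcΓ q))
      rw [this]
      exact Subtype.coe_le_coe.1 (hc c hcΓ)
    · exact (φ.eval z).2.2.trans (not_le.1 hε1).le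
  · intro m ε hε h0
    have hlt : (φ.iterInf k).eval (Fin.snoc (α := fun _ => M) (fun q => (p q : M)) m) <
        (⟨min ε 1, (lt_min hε one_pos).le, min_le_right _ _⟩ : unitInterval) := by
      have : (φ.iterInf k).eval (Fin.snoc (α := fun _ => M) (fun q => (p q : M)) m) = 0 := h0
      rw [this]
      exact Subtype.coe_lt_coe.1 (lt_min hε one_pos)
    obtain ⟨z, hz, hr⟩ := Formula.exists_of_eval_iterInf_lt k φ _ _ hlt
    refine ⟨fun l => if l ∈ J then y₀ l else z (ix l), fun l hl => if_pos hl, ?_, fun c hc => ?_⟩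
    · simp only [if_neg hi, hixi, hz, Fin.snoc_last]
    · have : c.eval (fun l => if l ∈ J then y₀ l else z (ix l)) = c.eval (fun l => z (ix l)) := by
        refine congrArg c.formula.eval (funext fun q => ?_)
        beta_reduce
        by_cases hq : c.idx q ∈ J
        · have h₁ : c.idx q ∈ F₁ := Finset.mem_filter.2 ⟨hmem c hc q, hq⟩
          have : ix (c.idx q) = Fin.castAdd k (e₁ ⟨c.idx q, h₁⟩).castSucc := by
            simp only [ix, dif_pos h₁]
          rw [if_pos hq, this, hz, Fin.snoc_castSucc]
          simp only [p, Equiv.symm_apply_apply]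
        · rw [if_neg hq]
      rw [this]
      exact (Subtype.coe_le_coe.2 ((hφ z _).1 hr.le c hc)).trans (min_le_left _ _)

/-- The assignment `p.2`, restricted to the variables in `p.1`, is compatible with approximately
satisfying any finitely many conditions in `Γ`. -/
def IsGoodPartial {I : Type w} (Γ : Set (S.VarCond I)) (p : Set I × (I → M)) : Prop :=
  ∀ Γ₀ ⊆ Γ, Γ₀.Finite → ∀ ε : ℝ, 0 < ε →
    ∃ y : I → M, Set.EqOn y p.2 p.1 ∧ ∀ c ∈ Γ₀, (c.eval y : ℝ) ≤ ε

/-- A value for one more variable is found by saturation: it has to satisfy the projections to this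
variable of all finite subsets of `Γ`. -/
theorem IsSaturated.exists_isGoodPartial_insert {κ : Cardinal.{x}} (hsat : IsSaturated S M κ)
    {I : Type w} (hI : Cardinal.lift.{x} #I < Cardinal.lift.{w} κ) {Γ : Set (S.VarCond I)}
    {J : Set I} {y₀ : I → M} (hgood : IsGoodPartial Γ (J, y₀)) {i : I} (hi : i ∉ J) :
    ∃ y₁ : I → M, Set.EqOn y₁ y₀ J ∧ IsGoodPartial Γ (insert i J, y₁) := by
  classical
  have hcard : #(y₀ '' J) < κ := by
    have h1 : Cardinal.lift.{w} #(y₀ '' J) ≤ Cardinal.lift.{x} #J := mk_image_le_lift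
    have h2 : Cardinal.lift.{x} #J ≤ Cardinal.lift.{x} #I := lift_le.2 (mk_set_le J)
    exact lift_lt.1 ((h1.trans h2).trans_lt hI)
  have : Nonempty (S.Cond (y₀ '' J)) :=
    (exists_cond_of_finite J y₀ i hi ∅ Set.finite_empty).nonempty
  choose! C hC₁ hC₂ using fun (Γ₀ : Set (S.VarCond I)) (hfin : Γ₀.Finite) =>
    exists_cond_of_finite J y₀ i hi Γ₀ hfin
  obtain ⟨m, hm⟩ := hsat (y₀ '' J) hcard (C '' {Γ₀ | Γ₀ ⊆ Γ ∧ Γ₀.Finite}) (by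
    intro D hD hDfin ε hε
    obtain ⟨E, hE, hEfin, hED⟩ := Set.exists_subset_image_finite_and.1 ⟨D, hD, hDfin, Eq.refl D⟩
    subst hED
    obtain ⟨y, hy, hyE⟩ := hgood (⋃₀ E) (Set.sUnion_subset fun Γ₀ h => (hE h).1)
      (hEfin.sUnion fun Γ₀ h => (hE h).2) ε hε
    refine ⟨y i, ?_⟩
    rintro _ ⟨Γ₀, hΓ₀, rfl⟩
    exact hC₁ Γ₀ (hE hΓ₀).2 y hy ε hε fun c hc => hyE c ⟨Γ₀, hΓ₀, hc⟩)
  refine ⟨Function.update y₀ i m, fun l hl => ?_, fun Γ₀ hΓ₀ hfin ε hε => ?_⟩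
  · exact Function.update_of_ne (fun h : l = i => hi (h ▸ hl)) _ _
  · obtain ⟨y, hy, hyi, hc⟩ := hC₂ Γ₀ hfin m ε hε (hm _ ⟨Γ₀, ⟨hΓ₀, hfin⟩, rfl⟩)
    refine ⟨y, ?_, hc⟩
    rintro l (rfl | hl)
    · simp [hyi]
    · simp only
      rw [hy hl, Function.update_of_ne (fun h : l = i => hi (h ▸ hl))]

/-- In a `κ`-saturated structure, a set of conditions in fewer than `κ` variables which is finitely
satisfiable up to arbitrarily small errors is realized. -/
theorem IsSaturated.exists_realization {κ : Cardinal.{x}} (hsat : IsSaturated S M κ)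
    {I : Type w} (hI : Cardinal.lift.{x} #I < Cardinal.lift.{w} κ) (Γ : Set (S.VarCond I))
    (hΓ : ∀ Γ₀ ⊆ Γ, Γ₀.Finite → ∀ ε : ℝ, 0 < ε →
      ∃ y : I → M, ∀ c ∈ Γ₀, (c.eval y : ℝ) ≤ ε) :
    ∃ y : I → M, ∀ c ∈ Γ, c.eval y = 0 := by
  classical
  let P := {p : Set I × (I → M) // IsGoodPartial Γ p}
  let r : P → P → Prop := fun p q => p.1.1 ⊆ q.1.1 ∧ Set.EqOn q.1.2 p.1.2 p.1.1
  obtain ⟨y₀, -⟩ := hΓ ∅ (Set.empty_subset _) Set.finite_empty 1 one_pos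
  obtain ⟨⟨⟨J, y₁⟩, hgood⟩, hmax⟩ := exists_maximal_of_chains_bounded (r := r) (by
    intro c hc
    -- An upper bound of a chain is the common extension of its members.
    let J : Set I := ⋃ p ∈ c, p.1.1
    have hex : ∀ i ∈ J, ∃ p ∈ c, i ∈ p.1.1 := fun i hi => by simpa [J] using hi
    have : Nonempty P := ⟨⟨(∅, y₀), fun Γ₀ hΓ₀ hfin ε hε =>
      (hΓ Γ₀ hΓ₀ hfin ε hε).imp fun y hy => ⟨Set.eqOn_empty _ _, hy⟩⟩⟩
    choose! q hqc hq using hex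
    let z : I → M := fun i => if i ∈ J then (q i).1.2 i else y₀ i
    have hz : ∀ p ∈ c, Set.EqOn z p.1.2 p.1.1 := by
      intro p hp i hi
      have hiJ : i ∈ J := Set.mem_biUnion hp hi
      simp only [z, if_pos hiJ]
      by_cases hpq : p = q i
      · rw [← hpq]
      · rcases hc hp (hqc i hiJ) hpq with h | h
        · exact h.2 hi
        · exact (h.2 (hq i hiJ)).symm
    have hzgood : IsGoodPartial Γ (J, z) := by
      intro Γ₀ hΓ₀ hfin ε hε
      have hF : ((⋃ d ∈ Γ₀, Set.range d.idx) ∩ J).Finite :=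
        (hfin.biUnion fun d _ => Set.finite_range _).subset Set.inter_subset_left
      -- Finitely many variables already occur in a single member of the chain.
      have hex : ∃ y : I → M, (∀ d ∈ Γ₀, (d.eval y : ℝ) ≤ ε) ∧
          Set.EqOn y z ((⋃ d ∈ Γ₀, Set.range d.idx) ∩ J) := by
        rcases c.eq_empty_or_nonempty with rfl | hne
        · obtain ⟨y, hy⟩ := hΓ Γ₀ hΓ₀ hfin ε hε
          refine ⟨y, hy, fun i hi => ?_⟩
          simp [J] at hi
        · have hdir : DirectedOn (fun p q : P => p.1.1 ⊆ q.1.1) c := by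
            intro p hp q hq
            by_cases hpq : p = q
            · exact ⟨p, hp, subset_rfl, hpq ▸ subset_rfl⟩
            · rcases hc hp hq hpq with h | h
              · exact ⟨q, hq, h.1, subset_rfl⟩
              · exact ⟨p, hp, subset_rfl, h.1⟩
          obtain ⟨p, hp, hpF⟩ := Set.Finite.induction_on_subset
            (motive := fun T _ => ∃ p ∈ c, T ⊆ p.1.1) _ hF
            (hne.imp fun p hp => ⟨hp, Set.empty_subset _⟩) (by
              intro a T ha _ _ ⟨p, hp, hT⟩
              obtain ⟨p', hp', h1, h2⟩ := hdir p hp (q a) (hqc a ha.2)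
              exact ⟨p', hp', Set.insert_subset (h2 (hq a ha.2)) (hT.trans h1)⟩)
          obtain ⟨y, hy, hyc⟩ := p.2 Γ₀ hΓ₀ hfin ε hε
          exact ⟨y, hyc, fun i hi => (hy (hpF hi)).trans (hz p hp (hpF hi)).symm⟩
      obtain ⟨y, hy, hyz⟩ := hex
      refine ⟨fun i => if i ∈ J then z i else y i, fun i hi => if_pos hi, fun d hd => ?_⟩
      have : d.eval (fun i => if i ∈ J then z i else y i) = d.eval y := by
        refine congrArg d.formula.eval (funext fun k => ?_)
        beta_reduce
        by_cases hk : d.idx k ∈ J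
        · rw [if_pos hk, hyz ⟨Set.mem_biUnion hd ⟨k, rfl⟩, hk⟩]
        · rw [if_neg hk]
      rw [this]
      exact hy d hd
    exact ⟨⟨(J, z), hzgood⟩, fun p hp => ⟨fun i hi => Set.mem_biUnion hp hi, hz p hp⟩⟩)
    (fun {p q s} hpq hqs => ⟨hpq.1.trans hqs.1,
      fun i hi => (hqs.2 (hpq.1 hi)).trans (hpq.2 hi)⟩)
  have hJ : J = Set.univ := by
    refine Set.eq_univ_of_forall fun i => ?_
    by_contra hi
    obtain ⟨y₂, hy₂, hgood₂⟩ := hsat.exists_isGoodPartial_insert hI hgood hi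
    exact hi ((hmax ⟨_, hgood₂⟩ ⟨Set.subset_insert _ _, hy₂⟩).1 (Set.mem_insert i J))
  subst hJ
  refine ⟨y₁, fun c hc => ?_⟩
  refine Subtype.ext (le_antisymm (le_of_forall_pos_le_add fun ε hε => ?_) (c.eval y₁).2.1)
  obtain ⟨y, hy, hyc⟩ := hgood {c} (Set.singleton_subset_iff.2 hc) (Set.finite_singleton c) ε hε
  have : y = y₁ := funext fun i => hy (Set.mem_univ i)
  subst this
  simpa using hyc c rfl

end MetricSignature

/-! ### Quantifier-free types and embeddings -/

namespace FirstOrder.Language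

variable {L : FirstOrder.Language.{u, v}}

section QFType

variable {I : Type w} {J : Type x} [L.Structure I] [L.Structure J]

theorem SameQFType.symm {n : ℕ} {i : Fin n → I} {j : Fin n → J} (h : L.SameQFType i j) :
    L.SameQFType j i :=
  fun φ hφ => (h φ hφ).symm

theorem SameQFType.trans {K : Type*} [L.Structure K] {n : ℕ} {i : Fin n → I} {j : Fin n → J}
    {k : Fin n → K} (h : L.SameQFType i j) (h' : L.SameQFType j k) : L.SameQFType i k :=
  fun φ hφ => (h φ hφ).trans (h' φ hφ)

theorem sameQFType_embedding (f : I ↪[L] J) {n : ℕ} (i : Fin n → I) :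
    L.SameQFType i (fun k => f (i k)) := by
  intro φ hφ
  have := hφ.realize_embedding f (v := i) (xs := default)
  rw [Subsingleton.elim (f ∘ default) default] at this
  exact this.symm

theorem SameQFType.realize_eq_iff {n : ℕ} {i : Fin n → I} {j : Fin n → J}
    (h : L.SameQFType i j) (t₁ t₂ : L.Term (Fin n)) :
    t₁.realize i = t₂.realize i ↔ t₁.realize j = t₂.realize j := by
  have := h (t₁.equal t₂) (BoundedFormula.IsAtomic.equal _ _).isQF
  simpa only [Formula.realize_equal] using this

theorem SameQFType.relMap_iff {n : ℕ} {i : Fin n → I} {j : Fin n → J}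
    (h : L.SameQFType i j) {m : ℕ} (R : L.Relations m) (ts : Fin m → L.Term (Fin n)) :
    Structure.RelMap R (fun k => (ts k).realize i) ↔
      Structure.RelMap R (fun k => (ts k).realize j) := by
  have := h (R.formula ts) (BoundedFormula.IsAtomic.rel _ _).isQF
  simpa only [Formula.realize_rel] using this

/-- The quantifier-free type of a generating tuple determines the structure. -/
theorem SameQFType.exists_embedding {n : ℕ} {i : Fin n → I} {j : Fin n → J}
    (h : L.SameQFType i j) (hgen : Substructure.closure L (Set.range i) = ⊤) :
    ∃ g : I ↪[L] J, ∀ k, g (i k) = j k := by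
  have hterm : ∀ x : I, ∃ t : L.Term (Fin n), t.realize i = x := by
    intro x
    have hx : x ∈ Substructure.closure L (Set.range i) := hgen ▸ Substructure.mem_top x
    obtain ⟨t, rfl⟩ := Substructure.mem_closure_iff_exists_term.1 hx
    refine ⟨t.relabel (fun s => s.2.choose), ?_⟩
    rw [Term.realize_relabel]
    congr 1
    funext s
    exact s.2.choose_spec
  choose τ hτ using hterm
  refine ⟨⟨⟨fun x => (τ x).realize j, fun x y hxy => ?_⟩, fun {m} f x => ?_, fun {m} R x => ?_⟩,
    fun k => ?_⟩
  · rw [← hτ x, ← hτ y]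
    exact (h.realize_eq_iff _ _).2 hxy
  · refine (h.realize_eq_iff (τ (Structure.funMap f x)) (.func f fun k => τ (x k))).1 ?_
    simp only [hτ, Term.realize_func]
  · have := h.relMap_iff R fun k => τ (x k)
    simp only [hτ] at this
    exact this.symm
  · exact (h.realize_eq_iff (τ (i k)) (.var k)).1 (by simp only [hτ, Term.realize_var])

/-- A tuple, viewed in the substructure which it generates. -/
def closureTuple {n : ℕ} (i : Fin n → I) (k : Fin n) : Substructure.closure L (Set.range i) :=
  ⟨i k, Substructure.subset_closure ⟨k, rfl⟩⟩

/-- The map `i ↦ j` extends to an embedding of the substructure generated by `i`. -/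
theorem SameQFType.exists_closure_embedding {n : ℕ} {i : Fin n → I} {j : Fin n → J}
    (h : L.SameQFType i j) :
    ∃ g : Substructure.closure L (Set.range i) ↪[L] J, ∀ k, g (closureTuple i k) = j k := by
  refine SameQFType.exists_embedding (i := closureTuple i)
    (((sameQFType_embedding (Substructure.subtype _) (closureTuple i)).trans h)) ?_
  rw [eq_top_iff]
  rintro x -
  have hx : (Substructure.closure L (Set.range i)).subtype x ∈ (Substructure.closure L
      (Set.range (closureTuple (L := L) i))).map (Substructure.subtype _).toHom := by
    rw [← Substructure.closure_image, ← Set.range_comp]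
    exact x.2
  obtain ⟨y, hy, hyx⟩ := hx
  rwa [← (Substructure.subtype _).injective hyx]

end QFType

section Age

variable {I : Type w} [L.Structure I]

theorem IsLocallyFinite.finite_of_mem_age (hI : L.IsLocallyFinite I)
    {B : CategoryTheory.Bundled.{w} L.Structure} (hB : B ∈ L.age I) : Finite B := by
  obtain ⟨hfg, ⟨f⟩⟩ := hB
  have := hI _ (hfg.range f.toHom)
  exact Finite.of_equiv _ f.equivRange.symm.toEquiv

theorem mem_age_of_embedding {B : CategoryTheory.Bundled.{w} L.Structure} (hB : B ∈ L.age I)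
    {A : Type w} [L.Structure A] [Finite A] (g : A ↪[L] B) :
    CategoryTheory.Bundled.of (c := L.Structure) A ∈ L.age I :=
  ⟨Structure.FG.of_finite (M := A), hB.2.map fun f => f.comp g⟩

theorem mem_age_of_finite (B : L.Substructure I) [Finite B] :
    CategoryTheory.Bundled.of (c := L.Structure) B ∈ L.age I :=
  ⟨Structure.FG.of_finite (M := B), ⟨B.subtype⟩⟩

variable (L I) in
/-- A finite coloring of the embeddings of some structure into `I`. -/
structure EmbColoring where
  A : Type w
  [str : L.Structure A]
  r : ℕ
  color : (A ↪[L] I) → Fin r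

attribute [instance] EmbColoring.str

/-- The coloring `c` is constant on the embeddings which factor through `f`. -/
def EmbColoring.IsConstantOn (c : L.EmbColoring I) {D : Type w} [L.Structure D] (f : D ↪[L] I) :
    Prop :=
  ∀ g g' : c.A ↪[L] D, c.color (f.comp g) = c.color (f.comp g')

/-- Iterating the embedding Ramsey property makes finitely many colorings constant at once. -/
theorem HasERP.exists_isConstantOn (hI : L.IsLocallyFinite I) (hR : HasERP (L.age I))
    (l : List (L.EmbColoring I)) : ∀ D ∈ L.age I, ∃ f : D ↪[L] I, ∀ c ∈ l, c.IsConstantOn f := by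
  induction l with
  | nil => exact fun D hD => hD.2.elim fun f => ⟨f, by simp⟩
  | cons c l ih =>
    intro D hD
    by_cases hne : Nonempty (c.A ↪[L] D)
    · -- The Ramsey property is applied to the copy of `c.A` in `D` given by `g₀`.
      obtain ⟨g₀⟩ := hne
      have := hI.finite_of_mem_age hD
      obtain ⟨C, hC, hCD⟩ := hR D hD g₀.toHom.range
        (mem_age_of_embedding hD (Substructure.subtype _)) c.r
      obtain ⟨f, hf⟩ := ih C hC
      obtain ⟨e, he⟩ := hCD fun h => c.color (f.comp (h.comp g₀.equivRange.toEmbedding))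
      refine ⟨f.comp e, List.forall_mem_cons.2 ⟨fun g g' => ?_, fun d hd g g' => ?_⟩⟩
      · have key : ∀ g : c.A ↪[L] D, (f.comp e).comp g = f.comp ((e.comp
            (g.comp g₀.equivRange.symm.toEmbedding)).comp g₀.equivRange.toEmbedding) := by
          intro g
          ext x
          simp
        rw [key g, key g']
        exact he _ _
      · simpa only [Embedding.comp_assoc] using hf d hd (e.comp g) (e.comp g')
    · obtain ⟨f, hf⟩ := ih D hD
      exact ⟨f, List.forall_mem_cons.2 ⟨fun g => (hne ⟨g⟩).elim, hf⟩⟩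

end Age

end FirstOrder.Language

/-! ### The embedding Ramsey property yields indiscernibles -/

namespace MetricSignature

variable {S : MetricSignature.{s, t}}

/-- The connective `|v₀ - v₁|`. -/
noncomputable def absDiffConn : C(Fin 2 → unitInterval, unitInterval) where
  toFun v := ⟨|(v 0 : ℝ) - v 1|, abs_nonneg _,
    abs_le.2 ⟨by linarith [(v 0).2.1, (v 1).2.2], by linarith [(v 0).2.2, (v 1).2.1]⟩⟩
  continuous_toFun := by fun_prop

/-- The connective measuring the distance (cut off at `1`) to a set. -/
noncomputable def infDistConn {k : ℕ} (T : Set (Fin k → unitInterval)) :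
    C(Fin k → unitInterval, unitInterval) where
  toFun v := Set.projIcc 0 1 zero_le_one (Metric.infDist v T)
  continuous_toFun := continuous_projIcc.comp (Metric.continuous_infDist_pt T)

theorem infDistConn_eq_zero_of_mem {k : ℕ} {T : Set (Fin k → unitInterval)}
    {v : Fin k → unitInterval} (h : v ∈ T) : infDistConn T v = 0 :=
  Set.projIcc_of_le_left zero_le_one (Metric.infDist_zero_of_mem h).le

theorem exists_dist_lt_of_infDistConn_eq_zero {k : ℕ} {T : Set (Fin k → unitInterval)}
    (hT : T.Nonempty) {v : Fin k → unitInterval} (h : infDistConn T v = 0) {ε : ℝ} (hε : 0 < ε) :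
    ∃ z ∈ T, dist v z < ε := by
  have h0 : Metric.infDist v T ≤ 0 := (Set.projIcc_eq_left one_pos).1 h
  exact (Metric.infDist_lt_iff hT).1 (h0.trans_lt hε)

variable {I : Type w}

/-- The condition `|φ(x_i) - φ(x_j)| = 0`. -/
noncomputable def VarCond.diff {n : ℕ} (φ : S.Formula n) (i j : Fin n → I) : S.VarCond I :=
  ⟨n + n, .conn absDiffConn
    (fun q => if q = 0 then φ.rename (Fin.castAdd n) else φ.rename (Fin.natAdd n)), Fin.append i j⟩

/-- The condition that the values of finitely many formulas at `x_j` lie in the closure of `T`. -/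
noncomputable def VarCond.nearSet {n k : ℕ} (φs : Fin k → S.Formula n) (j : Fin n → I)
    (T : Set (Fin k → unitInterval)) : S.VarCond I :=
  ⟨n, .conn (infDistConn T) φs, j⟩

variable {M : Type x} [MetricSpace M] [S.Structure M]

theorem VarCond.eval_diff {n : ℕ} (φ : S.Formula n) (i j : Fin n → I) (y : I → M) :
    ((VarCond.diff φ i j).eval y : ℝ) =
      |(φ.eval (fun k => y (i k)) : ℝ) - φ.eval (fun k => y (j k))| := by
  simp [VarCond.diff, VarCond.eval, Formula.eval, absDiffConn, Formula.eval_rename,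
    -Fin.natAdd_eq_addNat]

theorem VarCond.eval_nearSet {n k : ℕ} (φs : Fin k → S.Formula n) (j : Fin n → I)
    (T : Set (Fin k → unitInterval)) (y : I → M) :
    (VarCond.nearSet φs j T).eval y = infDistConn T (fun q => (φs q).eval (fun k => y (j k))) :=
  rfl

end MetricSignature

namespace FirstOrder.Language

open MetricSignature

variable {L : FirstOrder.Language.{u, v}} {I : Type w} [L.Structure I]
  {S : MetricSignature.{s, t}} {M : Type x} [MetricSpace M] [S.Structure M]

theorem abs_sub_le_of_floor_eq {p q ε : ℝ} (hp : 0 ≤ p) (hq : 0 ≤ q) {N : ℕ} (hN : 1 ≤ N * ε)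
    (hN0 : 0 < N) (h : ⌊p * N⌋₊ = ⌊q * N⌋₊) : |p - q| ≤ ε := by
  have hNpos : (0 : ℝ) < N := by exact_mod_cast hN0
  have h1 := Nat.floor_le (mul_nonneg hp hNpos.le)
  have h2 := Nat.lt_floor_add_one (p * N)
  have h3 := Nat.floor_le (mul_nonneg hq hNpos.le)
  have h4 := Nat.lt_floor_add_one (q * N)
  rw [h] at h1 h2
  refine abs_le.2 ⟨?_, ?_⟩
  · by_contra hlt
    nlinarith
  · by_contra hlt
    nlinarith

/-- If `i` and `j` have the same quantifier-free type, then a suitable coloring of the embeddings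
of the structure generated by `i` controls `|φ(a_{f(i)}) - φ(a_{f(j)})|`. -/
theorem SameQFType.exists_embColoring {n : ℕ} {i j : Fin n → I} (h : L.SameQFType i j)
    (φ : S.Formula n) (a : I → M) {ε : ℝ} (hε : 0 < ε) :
    ∃ c : L.EmbColoring I, ∀ (B : L.Substructure I), (∀ k, i k ∈ B) → (∀ k, j k ∈ B) →
      ∀ f : B ↪[L] I, c.IsConstantOn f → ∀ y : I → M, (∀ b : B, y b = a (f b)) →
        ((VarCond.diff φ i j).eval y : ℝ) ≤ ε := by
  obtain ⟨N, hN⟩ := exists_nat_gt (1 / ε)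
  have hN1 : 1 ≤ N * ε := ((div_lt_iff₀ hε).1 hN).le
  have hN0 : 0 < N := by
    have : (0 : ℝ) < N := (one_div_pos.2 hε).trans hN
    exact_mod_cast this
  -- The color of an embedding is the value of `φ`, rounded down to a multiple of `1 / N`.
  let val : (Fin n → M) → Fin (N + 1) := fun z => ⟨⌊(φ.eval z : ℝ) * N⌋₊, Nat.lt_succ_of_le
    (Nat.floor_le_of_le (mul_le_of_le_one_left N.cast_nonneg (φ.eval z).2.2))⟩
  refine ⟨⟨Substructure.closure L (Set.range i), N + 1,
    fun e => val (fun k => a (e (closureTuple i k)))⟩, fun B hi hj f hf y hy => ?_⟩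
  have hle : Substructure.closure L (Set.range i) ≤ B :=
    Substructure.closure_le.2 (Set.range_subset_iff.2 hi)
  have hjB : L.SameQFType (fun k => (⟨j k, hj k⟩ : B)) j :=
    sameQFType_embedding B.subtype (fun k => (⟨j k, hj k⟩ : B))
  obtain ⟨g, hg⟩ := (h.trans hjB.symm).exists_closure_embedding
  have := congrArg Fin.val (hf (Substructure.inclusion hle) g)
  rw [VarCond.eval_diff]
  refine abs_sub_le_of_floor_eq (φ.eval _).2.1 (φ.eval _).2.1 hN1 hN0 ?_
  have e₁ : (fun k => y (i k)) =
      fun k => a ((f.comp (Substructure.inclusion hle)) (closureTuple i k)) :=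
    funext fun k => hy ⟨i k, hi k⟩
  have e₂ : (fun k => y (j k)) = fun k => a ((f.comp g) (closureTuple i k)) := by
    funext k
    rw [Embedding.comp_apply, hg k]
    exact hy ⟨j k, hj k⟩
  rw [e₁, e₂]
  exact this

/-- In a saturated structure, the embedding Ramsey property of the age provides indiscernible
sequences locally based on a given one. -/
theorem HasERP.exists_isIndiscernible (hI : L.IsLocallyFinite I) (hR : HasERP (L.age I))
    {κ : Cardinal.{x}} (hsat : IsSaturated S M κ)
    (hκ : Cardinal.lift.{x} #I < Cardinal.lift.{w} κ) (a : I → M) :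
    ∃ b : I → M, L.IsIndiscernible S b ∧ L.IsLocallyBasedOn S b a := by
  classical
  -- `Γ₁` expresses indiscernibility, and `Γ₂` that the sequence is locally based on `a`.
  let Γ₁ : Set (S.VarCond I) :=
    {c | ∃ (n : ℕ) (φ : S.Formula n) (i j : Fin n → I), L.SameQFType i j ∧ c = .diff φ i j}
  let T : ∀ (n k : ℕ) (_ : Fin k → S.Formula n) (_ : Fin n → I), Set (Fin k → unitInterval) :=
    fun n k φs j => {z | ∃ i : Fin n → I, L.SameQFType i j ∧
      z = fun q => (φs q).eval (fun l => a (i l))}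
  let Γ₂ : Set (S.VarCond I) :=
    {c | ∃ (n k : ℕ) (φs : Fin k → S.Formula n) (j : Fin n → I), c = .nearSet φs j (T n k φs j)}
  obtain ⟨b, hb⟩ := hsat.exists_realization hκ (Γ₁ ∪ Γ₂) (by
    intro Γ₀ hΓ₀ hfin ε hε
    have hcol : ∀ c ∈ Γ₀, c ∈ Γ₁ → ∃ d : L.EmbColoring I, ∀ (B : L.Substructure I),
        (∀ k, c.idx k ∈ B) → ∀ f : B ↪[L] I, d.IsConstantOn f → ∀ y : I → M,
          (∀ b : B, y b = a (f b)) → (c.eval y : ℝ) ≤ ε := by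
      rintro c - ⟨n, φ, i, j, hij, rfl⟩
      obtain ⟨d, hd⟩ := hij.exists_embColoring φ a hε
      refine ⟨d, fun B hB => hd B (fun k => ?_) (fun k => ?_)⟩
      · simpa [VarCond.diff, -Fin.natAdd_eq_addNat] using hB (Fin.castAdd n k)
      · simpa [VarCond.diff, -Fin.natAdd_eq_addNat] using hB (Fin.natAdd n k)
    have : Nonempty (L.EmbColoring I) := ⟨⟨I, 1, fun _ => 0⟩⟩
    choose! d hd using hcol
    let F : Set I := ⋃ c ∈ Γ₀, Set.range c.idx
    have hF : F.Finite := hfin.biUnion fun c _ => Set.finite_range _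
    let B := Substructure.closure L F
    have hBfin : Finite B := hI B (Substructure.fg_closure hF)
    have hB : ∀ c ∈ Γ₀, ∀ k, c.idx k ∈ B := fun c hc k =>
      Substructure.subset_closure (Set.mem_biUnion hc ⟨k, rfl⟩)
    obtain ⟨f, hf⟩ := hR.exists_isConstantOn hI (hfin.toFinset.toList.map d)
      (CategoryTheory.Bundled.of B) (mem_age_of_finite B)
    let y : I → M := fun l => if h : l ∈ B then a (f ⟨l, h⟩) else a l
    have hy : ∀ b : B, y b = a (f b) := fun b => dif_pos b.2
    refine ⟨y, fun c hc => ?_⟩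
    rcases hΓ₀ hc with h₁ | ⟨n, k, φs, j, rfl⟩
    · exact hd c hc h₁ B (hB c hc) f
        (hf _ (List.mem_map.2 ⟨c, by simpa using hc, rfl⟩)) y hy
    · -- The embedding `f` preserves quantifier-free types.
      have hj : ∀ l, j l ∈ B := hB _ hc
      rw [VarCond.eval_nearSet, infDistConn_eq_zero_of_mem]
      · exact hε.le
      · refine ⟨fun l => f ⟨j l, hj l⟩, ?_, ?_⟩
        · exact (sameQFType_embedding f (fun l => (⟨j l, hj l⟩ : B))).symm.trans
            (sameQFType_embedding B.subtype (fun l => (⟨j l, hj l⟩ : B)))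
        · funext q
          exact congrArg (φs q).eval (funext fun l => hy ⟨j l, hj l⟩))
  refine ⟨b, fun n i j hij φ => ?_, fun n Δ hΔ j ε hε => ?_⟩
  · have := congrArg Subtype.val (hb _ (Or.inl ⟨n, φ, i, j, hij, rfl⟩))
    rw [VarCond.eval_diff] at this
    exact Subtype.ext (sub_eq_zero.1 (abs_eq_zero.1 this))
  · let e := hΔ.toFinset.equivFin
    let φs : Fin hΔ.toFinset.card → S.Formula n := fun q => (e.symm q).1
    obtain ⟨_, ⟨i, hi, rfl⟩, hz⟩ := exists_dist_lt_of_infDistConn_eq_zero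
      (T := T n _ φs j) ⟨_, j, fun _ _ => Iff.rfl, rfl⟩
      (hb _ (Or.inr ⟨n, _, φs, j, rfl⟩)) hε
    refine ⟨i, hi, fun φ hφ => ?_⟩
    let q := e ⟨φ, hΔ.mem_toFinset.2 hφ⟩
    have hq : φs q = φ := congrArg Subtype.val (e.symm_apply_apply _)
    have : dist ((φs q).eval fun k => b (j k)) ((φs q).eval fun k => a (i k)) ≤ ε :=
      ((dist_pi_lt_iff hε).1 hz q).le
    rw [hq] at this
    exact this

end FirstOrder.Language

/-! ### Ultrafilters realizing all small types -/

namespace GenericModel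

open Filter

/-- Names for elements of a saturated model: `mk Γ p` is meant to name an element which satisfies
all conditions in `Γ` with the parameters named by `p`. -/
inductive Name (Z : Type v) (K : Type w) : Type (max v w)
  | base : Name Z K
  | mk (Γ : Set ((K → Z) → Z → Prop)) (p : K → Name Z K) : Name Z K

variable {Z : Type v} {K : Type w} {X : Type x}

/-- Restriction of an assignment to the coordinates in `Y`. -/
def restr (Y : Set X) (v : X → Z) (i : Y) : Z := v i

/-- The set `Γ` of conditions over the parameters `p` is finitely satisfiable modulo `U`. -/
def IsFinSat (U : Ultrafilter (X → Z)) (Γ : Set ((K → Z) → Z → Prop)) (p : K → X) : Prop :=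
  ∀ Γ₀ ⊆ Γ, Γ₀.Finite → ∀ᶠ v : X → Z in U, ∃ y, ∀ C ∈ Γ₀, C (fun k => v (p k)) y

/-- Ultrafilters with the same restriction to `Y` agree on properties which only depend on the
coordinates in `Y`. -/
theorem eventually_iff_of_map_restrict_eq {Y : Set X} {U U' : Ultrafilter (X → Z)}
    (h : U.map (restr Y) = U'.map (restr Y)) {P : (X → Z) → Prop}
    (hP : ∀ v v', Set.EqOn v v' Y → P v → P v') : (∀ᶠ v : X → Z in U, P v) ↔ ∀ᶠ v : X → Z in U', P v := by
  let Q : Set (Y → Z) := {u | ∃ v, restr Y v = u ∧ P v}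
  have hQ : restr Y ⁻¹' Q = {v | P v} := by
    ext v
    refine ⟨?_, fun hv => ⟨v, rfl, hv⟩⟩
    rintro ⟨v', hv', hPv'⟩
    exact hP v' v (fun i hi => congrFun hv' ⟨i, hi⟩) hPv'
  change {v | P v} ∈ U ↔ {v | P v} ∈ U'
  rw [← hQ, ← Ultrafilter.mem_map, h, Ultrafilter.mem_map]

theorem IsFinSat.congr {Y : Set X} {U U' : Ultrafilter (X → Z)}
    (h : U.map (restr Y) = U'.map (restr Y)) {Γ : Set ((K → Z) → Z → Prop)} {p : K → X}
    (hp : ∀ k, p k ∈ Y) (hU : IsFinSat U' Γ p) : IsFinSat U Γ p := by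
  refine fun Γ₀ hΓ₀ hfin => (eventually_iff_of_map_restrict_eq h ?_).2 (hU Γ₀ hΓ₀ hfin)
  intro v v' hvv' hv
  rwa [← (funext fun k => hvv' (hp k) : (fun k => v (p k)) = fun k => v' (p k))]

/-- The filter of those sets in `U` which only depend on the coordinates in `Y`. -/
def restrictFilter (Y : Set X) (U : Ultrafilter (X → Z)) : Filter (X → Z) :=
  comap (restr Y) (map (restr Y) (U : Filter (X → Z)))

theorem le_restrictFilter (Y : Set X) (U : Ultrafilter (X → Z)) : ↑U ≤ restrictFilter Y U :=
  le_comap_map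

theorem map_restrict_eq_of_le {Y : Set X} {U U' : Ultrafilter (X → Z)}
    (h : ↑U' ≤ restrictFilter Y U) : U.map (restr Y) = U'.map (restr Y) := by
  refine (Ultrafilter.coe_le_coe.1 ?_).symm
  exact (map_mono h).trans map_comap_le

theorem map_restrict_eq_mono {Y Y' : Set X} (hY : Y ⊆ Y') {U U' : Ultrafilter (X → Z)}
    (h : U.map (restr Y') = U'.map (restr Y')) : U.map (restr Y) = U'.map (restr Y) := by
  have := congrArg (Ultrafilter.map fun u : Y' → Z => fun i : Y => u ⟨i, hY i.2⟩) h
  rwa [Ultrafilter.map_map, Ultrafilter.map_map] at this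

theorem restrictFilter_mono {Y Y' : Set X} (hY : Y ⊆ Y') {U U' : Ultrafilter (X → Z)}
    (h : U.map (restr Y) = U'.map (restr Y)) : restrictFilter Y' U' ≤ restrictFilter Y U := by
  have h2 : restrictFilter Y U = restrictFilter Y U' :=
    congrArg (fun W : Ultrafilter (Y → Z) => comap (restr Y) (W : Filter (Y → Z))) h
  rw [h2]
  refine map_le_iff_le_comap.1 ?_
  have h3 : (restr Y : (X → Z) → Y → Z) =
    (fun u : Y' → Z => fun i : Y => u ⟨i, hY i.2⟩) ∘ (restr Y') := rfl
  rw [h3, ← map_map, ← map_map]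
  exact map_mono map_comap_le

/-- `Y` is closed under subnames, and `U` realizes the conditions of all names in `Y` which are
finitely satisfiable. -/
structure IsRealizing (Y : Set (Name Z K)) (U : Ultrafilter (Name Z K → Z)) : Prop where
  mem : ∀ Γ p, Name.mk Γ p ∈ Y → ∀ k, p k ∈ Y
  realizes : ∀ Γ p, Name.mk Γ p ∈ Y → IsFinSat U Γ p →
    ∀ C ∈ Γ, ∀ᶠ v : Name Z K → Z in U, C (fun k => v (p k)) (v (.mk Γ p))

theorem IsRealizing.congr {Y : Set (Name Z K)} {U U' : Ultrafilter (Name Z K → Z)}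
    (h : U.map (restr Y) = U'.map (restr Y)) (hU : IsRealizing Y U) {Γ p}
    (hmem : Name.mk Γ p ∈ Y) (hfs : IsFinSat U' Γ p) :
    ∀ C ∈ Γ, ∀ᶠ v : Name Z K → Z in U', C (fun k => v (p k)) (v (.mk Γ p)) := by
  intro C hC
  refine (eventually_iff_of_map_restrict_eq h ?_).1
    (hU.realizes Γ p hmem (hfs.congr h (hU.mem Γ p hmem)) C hC)
  intro v v' hvv' hv
  rwa [← hvv' hmem, ← (funext fun k => hvv' (hU.mem Γ p hmem k) :
    (fun k => v (p k)) = fun k => v' (p k))]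

/-- If the conditions of `mk Γ p` are finitely satisfiable modulo `U`, then `U` can be changed,
outside the coordinates in `Y`, so that they are realized at the coordinate `mk Γ p`. -/
theorem exists_realizing_coordinate {Y : Set X} {U : Ultrafilter (X → Z)}
    {Γ : Set ((K → Z) → Z → Prop)} {p : K → X} (hp : ∀ k, p k ∈ Y) {c : X} (hc : c ∉ Y)
    (hfs : IsFinSat U Γ p) : ∃ U' : Ultrafilter (X → Z), U.map (restr Y) = U'.map (restr Y) ∧
      ∀ C ∈ Γ, ∀ᶠ v : X → Z in U', C (fun k => v (p k)) (v c) := by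
  classical
  let R : Γ → Set (X → Z) := fun C => {v | C.1 (fun k => v (p k)) (v c)}
  have hne : (restrictFilter Y U ⊓ ⨅ C, 𝓟 (R C)).NeBot := by
    refine (((map (restr Y) (U : Filter (X → Z))).basis_sets.comap (restr Y)).inf
      (hasBasis_iInf_principal_finite R)).neBot_iff.2 ?_
    rintro ⟨E, T⟩ ⟨hE, hT⟩
    have h₁ := hfs (Subtype.val '' T) (by rintro _ ⟨C, -, rfl⟩; exact C.2) (hT.image _)
    have h₂ : ∀ᶠ v : X → Z in U, restr Y v ∈ E := mem_map.1 hE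
    obtain ⟨v, hvE, y, hy⟩ := (h₂.and h₁).exists
    have hupd : ∀ i ∈ Y, Function.update v c y i = v i := fun i hi =>
      Function.update_of_ne (fun h : i = c => hc (h ▸ hi)) _ _
    refine ⟨Function.update v c y, ?_, Set.mem_iInter₂.2 fun C hC => ?_⟩
    · change restr Y (Function.update v c y) ∈ E
      rwa [(funext fun i => hupd i i.2 : restr Y (Function.update v c y) = restr Y v)]
    · change C.1 (fun k => Function.update v c y (p k)) (Function.update v c y c)
      rw [(funext fun k => hupd _ (hp k) :
        (fun k => Function.update v c y (p k)) = fun k => v (p k)), Function.update_self]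
      exact hy C ⟨C, hC, rfl⟩
  have hle := Ultrafilter.of_le (restrictFilter Y U ⊓ ⨅ C, 𝓟 (R C))
  refine ⟨Ultrafilter.of _, map_restrict_eq_of_le (hle.trans inf_le_left), fun C hC => ?_⟩
  exact hle.trans (inf_le_right.trans (iInf_le _ ⟨C, hC⟩)) (mem_principal_self _)

/-- A name can be added to `Y` once all its subnames are in `Y`. -/
theorem IsRealizing.exists_insert {Y : Set (Name Z K)} {U : Ultrafilter (Name Z K → Z)}
    (hU : IsRealizing Y U) {c : Name Z K} (hc : c ∉ Y)
    (hsub : ∀ Γ p, c = .mk Γ p → ∀ k, p k ∈ Y) :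
    ∃ U' : Ultrafilter (Name Z K → Z), U.map (restr Y) = U'.map (restr Y) ∧
      IsRealizing (insert c Y) U' := by
  have key : ∃ U' : Ultrafilter (Name Z K → Z), U.map (restr Y) = U'.map (restr Y) ∧
      ∀ Γ p, c = .mk Γ p → IsFinSat U Γ p →
        ∀ C ∈ Γ, ∀ᶠ v : Name Z K → Z in U', C (fun k => v (p k)) (v c) := by
    cases c with
    | base => exact ⟨U, rfl, fun Γ p h => by cases h⟩
    | mk Γ p =>
      by_cases hfs : IsFinSat U Γ p
      · obtain ⟨U', h, h'⟩ := exists_realizing_coordinate (hsub Γ p rfl) hc hfs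
        exact ⟨U', h, fun Γ' p' heq _ => by cases heq; exact h'⟩
      · exact ⟨U, rfl, fun Γ' p' heq hfs' => by cases heq; exact (hfs hfs').elim⟩
  obtain ⟨U', h, h'⟩ := key
  refine ⟨U', h, ⟨fun Γ p hmem k => ?_, fun Γ p hmem hfs => ?_⟩⟩
  · rcases hmem with hmem | hmem
    · exact Or.inr (hsub Γ p hmem.symm k)
    · exact Or.inr (hU.mem Γ p hmem k)
  · rcases hmem with hmem | hmem
    · have := h' Γ p hmem.symm (hfs.congr h (hsub Γ p hmem.symm))
      rwa [hmem]
    · exact hU.congr h hmem hfs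

/-- There is an ultrafilter modulo which every finitely satisfiable set of conditions with
parameters indexed by `K` is realized. -/
theorem exists_saturated_ultrafilter (Z : Type v) [Nonempty Z] (K : Type w) :
    ∃ U : Ultrafilter (Name Z K → Z), ∀ (Γ : Set ((K → Z) → Z → Prop)) (p : K → Name Z K),
      IsFinSat U Γ p → ∃ c, ∀ C ∈ Γ, ∀ᶠ v : Name Z K → Z in U, C (fun k => v (p k)) (v c) := by
  let P := {q : Set (Name Z K) × Ultrafilter (Name Z K → Z) // IsRealizing q.1 q.2}
  let r : P → P → Prop := fun q q' =>
    q.1.1 ⊆ q'.1.1 ∧ q.1.2.map (restr q.1.1) = q'.1.2.map (restr q.1.1)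
  obtain ⟨⟨⟨Y, U⟩, hU⟩, hmax⟩ := exists_maximal_of_chains_bounded (r := r) (by
    intro c hc
    rcases c.eq_empty_or_nonempty with rfl | hne
    · let v₀ : Name Z K → Z := fun _ => Classical.arbitrary Z
      exact ⟨⟨(∅, (pure v₀ : Ultrafilter (Name Z K → Z))), by constructor <;> simp⟩, by simp⟩
    · -- The upper bound extends the filter generated by the restrictions of the chain's members.
      have : Nonempty c := hne.to_subtype
      let F : c → Filter (Name Z K → Z) := fun q => restrictFilter q.1.1.1 q.1.1.2
      have hdir : Directed (· ≥ ·) F := by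
        intro q q'
        by_cases hqq' : q = q'
        · exact ⟨q, le_rfl, hqq' ▸ le_rfl⟩
        · rcases hc q.2 q'.2 (fun h => hqq' (Subtype.ext h)) with h | h
          · exact ⟨q', restrictFilter_mono h.1 h.2, le_rfl⟩
          · exact ⟨q, le_rfl, restrictFilter_mono h.1 h.2⟩
      have : (⨅ q, F q).NeBot := iInf_neBot_of_directed hdir fun q =>
        NeBot.mono q.1.1.2.neBot (le_restrictFilter _ _)
      let U := Ultrafilter.of (⨅ q, F q)
      have hUq : ∀ q ∈ c, q.1.2.map (restr q.1.1) = U.map (restr q.1.1) := fun q hq =>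
        map_restrict_eq_of_le ((Ultrafilter.of_le _).trans (iInf_le F ⟨q, hq⟩))
      refine ⟨⟨(⋃ q ∈ c, q.1.1, U), ⟨fun Γ p hmem k => ?_, fun Γ p hmem hfs => ?_⟩⟩,
        fun q hq => ⟨Set.subset_biUnion_of_mem (u := fun q : P => q.1.1) hq, hUq q hq⟩⟩
      · obtain ⟨q, hq, hmem⟩ := Set.mem_iUnion₂.1 hmem
        exact Set.mem_biUnion hq (q.2.mem Γ p hmem k)
      · obtain ⟨q, hq, hmem⟩ := Set.mem_iUnion₂.1 hmem
        exact q.2.congr (hUq q hq) hmem hfs)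
    (fun {q q' q''} h h' => ⟨h.1.trans h'.1, h.2.trans (map_restrict_eq_mono h.1 h'.2)⟩)
  have hins : ∀ c : Name Z K, (∀ Γ p, c = .mk Γ p → ∀ k, p k ∈ Y) → c ∈ Y := by
    intro c hsub
    by_contra hc
    obtain ⟨U', h, hU'⟩ := hU.exists_insert hc hsub
    exact hc ((hmax ⟨(insert c Y, U'), hU'⟩ ⟨Set.subset_insert _ _, h⟩).1 (Set.mem_insert _ _))
  have hY : ∀ c : Name Z K, c ∈ Y := by
    intro c
    induction c with
    | base => exact hins _ fun Γ p h => by cases h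
    | mk Γ p ih => exact hins _ fun Γ' p' h => by cases h; exact ih
  exact ⟨U, fun Γ p hfs => ⟨.mk Γ p, hU.realizes Γ p (hY _) hfs⟩⟩

end GenericModel

/-! ### The countable generic coloring -/

namespace GenericModel

section SameAtomic

variable {n : ℕ} {C : Type*} {α β γ ι ι' : Type*}

/-- Two families, in sets with colorings of the `n`-tuples, have the same atomic type. -/
def SameAtomic (col : (Fin n → α) → C) (col' : (Fin n → β) → C) (x : ι → α) (y : ι → β) : Prop :=
  (∀ i j, x i = x j ↔ y i = y j) ∧ ∀ s : Fin n → ι, col (fun k => x (s k)) = col' (fun k => y (s k))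

variable {col : (Fin n → α) → C} {col' : (Fin n → β) → C} {col'' : (Fin n → γ) → C}

theorem SameAtomic.symm {x : ι → α} {y : ι → β} (h : SameAtomic col col' x y) :
    SameAtomic col' col y x :=
  ⟨fun i j => (h.1 i j).symm, fun s => (h.2 s).symm⟩

theorem SameAtomic.trans {x : ι → α} {y : ι → β} {z : ι → γ} (h : SameAtomic col col' x y)
    (h' : SameAtomic col' col'' y z) : SameAtomic col col'' x z :=
  ⟨fun i j => (h.1 i j).trans (h'.1 i j), fun s => (h.2 s).trans (h'.2 s)⟩

theorem SameAtomic.comp {x : ι → α} {y : ι → β} (h : SameAtomic col col' x y) (f : ι' → ι) :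
    SameAtomic col col' (fun i => x (f i)) (fun i => y (f i)) :=
  ⟨fun i j => h.1 (f i) (f j), fun s => h.2 fun k => f (s k)⟩

end SameAtomic

variable (n r : ℕ)

/-- An enumeration of the finitely supported colorings of the `n`-tuples of `ℕ ∪ {∗}`. -/
noncomputable def decodeColoring : ℕ → ((Fin n → Option ℕ) →₀ Fin (r + 1)) :=
  (exists_surjective_nat _).choose

/-- The generic coloring of the `n`-tuples of natural numbers by `r + 1` colors: the greatest entry
`m` of a tuple codes the colors of all tuples of numbers at most `m` in which it occurs. -/
noncomputable def natColor (t : Fin n → ℕ) : Fin (r + 1) :=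
  decodeColoring n r (Nat.unpair (Finset.univ.sup t)).1
    (fun i => if t i = Finset.univ.sup t then none else some (t i))

/-- The extension property of the generic coloring: every coloring of the tuples from a finite set
and one new point `∗` in which `∗` occurs is induced by some number. -/
theorem exists_natColor_eq (F : Finset ℕ) (h : (Fin n → Option ℕ) → Fin (r + 1)) :
    ∃ m, (∀ a ∈ F, a < m) ∧ ∀ t : Fin n → Option ℕ, (∀ i, ∀ a ∈ t i, a ∈ F) → (∃ i, t i = none) →
      natColor n r (fun i => (t i).getD m) = h t := by
  classical
  let T : Finset (Fin n → Option ℕ) := Fintype.piFinset fun _ => F.insertNone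
  obtain ⟨c, hc⟩ := (exists_surjective_nat _).choose_spec (Finsupp.indicator T fun t _ => h t)
  let m := Nat.pair c (F.sup id + 1)
  have hm : ∀ a ∈ F, a < m := fun a ha =>
    (Nat.lt_succ_of_le (Finset.le_sup (f := id) ha)).trans_le (Nat.right_le_pair _ _)
  refine ⟨m, hm, fun t ht ⟨i, hi⟩ => ?_⟩
  have hsup : (Finset.univ.sup fun i => (t i).getD m) = m := by
    refine le_antisymm (Finset.sup_le fun j _ => ?_) ?_
    · cases htj : t j with
      | none => exact le_rfl
      | some a => exact (hm a (ht j a htj)).le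
    · have := Finset.le_sup (f := fun i => (t i).getD m) (Finset.mem_univ i)
      simpa [hi] using this
  have hpat : (fun i => if (t i).getD m = m then none else some ((t i).getD m)) = t := by
    funext j
    cases htj : t j with
    | none => simp
    | some a => simp [(hm a (ht j a htj)).ne]
  have htT : t ∈ T := Fintype.mem_piFinset.2 fun j => Finset.mem_insertNone.2 (ht j)
  unfold natColor
  rw [hsup, hpat, Nat.unpair_pair]
  have : decodeColoring n r c = Finsupp.indicator T fun t _ => h t := hc
  rw [this, Finsupp.indicator_of_mem htT]

/-- The finite partial isomorphisms of the generic coloring. -/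
def FinPartialIso : Type :=
  {S : Finset (ℕ × ℕ) // SameAtomic (natColor n r) (natColor n r)
    (fun p : S => p.1.1) (fun p : S => p.1.2)}

instance : PartialOrder (FinPartialIso n r) := inferInstanceAs (PartialOrder (Subtype _))

variable {n r}

/-- A new point `m` is mapped to a number which the extension property provides for the coloring
transported along the partial isomorphism. -/
theorem FinPartialIso.exists_forth (S : FinPartialIso n r) (m : ℕ) :
    ∃ S' : FinPartialIso n r, S ≤ S' ∧ ∃ b, (m, b) ∈ S'.1 := by
  classical
  by_cases hm : ∃ b, (m, b) ∈ S.1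
  · exact ⟨S, le_rfl, hm⟩
  let F := S.1.image Prod.snd
  let φ : ℕ → ℕ := fun b => if hb : ∃ a, (a, b) ∈ S.1 then hb.choose else 0
  have hφ : ∀ p ∈ S.1, φ p.2 = p.1 := by
    intro p hp
    have hb : ∃ a, (a, p.2) ∈ S.1 := ⟨p.1, hp⟩
    simp only [φ, dif_pos hb]
    exact (S.2.1 ⟨_, hb.choose_spec⟩ ⟨p, hp⟩).2 rfl
  obtain ⟨m', hF, hcol⟩ := exists_natColor_eq n r F
    (fun t => natColor n r fun i => (t i).elim m φ)
  refine ⟨⟨insert (m, m') S.1, ?_, fun s => ?_⟩, Finset.subset_insert _ _,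
    m', Finset.mem_insert_self _ _⟩
  · have hne : ∀ p ∈ S.1, m ≠ p.1 ∧ m' ≠ p.2 := fun p hp =>
      ⟨fun h => hm ⟨p.2, h ▸ hp⟩, (hF _ (Finset.mem_image_of_mem _ hp)).ne'⟩
    rintro ⟨p, hp⟩ ⟨q, hq⟩
    rcases Finset.mem_insert.1 hp with rfl | hp <;> rcases Finset.mem_insert.1 hq with rfl | hq
    · simp
    · simp [hne q hq]
    · simp [(hne p hp).1.symm, (hne p hp).2.symm]
    · exact S.2.1 ⟨p, hp⟩ ⟨q, hq⟩
  · by_cases hs : ∀ k, (s k).1 ∈ S.1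
    · exact S.2.2 fun k => ⟨(s k).1, hs k⟩
    · let t : Fin n → Option ℕ := fun k => if (s k).1 ∈ S.1 then some (s k).1.2 else none
      have hnew : ∀ k, (s k).1 ∉ S.1 → (s k).1 = (m, m') := fun k hk =>
        (Finset.mem_insert.1 (s k).2).resolve_right hk
      have h₁ : (fun k => (s k).1.1) = fun k => (t k).elim m φ := by
        funext k
        by_cases hk : (s k).1 ∈ S.1
        · simp only [t, if_pos hk, Option.elim_some, hφ _ hk]
        · simp only [t, if_neg hk, Option.elim_none, hnew k hk]
      have h₂ : (fun k => (s k).1.2) = fun k => (t k).getD m' := by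
        funext k
        by_cases hk : (s k).1 ∈ S.1
        · simp only [t, if_pos hk, Option.getD_some]
        · simp only [t, if_neg hk, Option.getD_none, hnew k hk]
      rw [h₁, h₂]
      refine (hcol t (fun k a ha => ?_) ?_).symm
      · by_cases hk : (s k).1 ∈ S.1
        · simp only [t, if_pos hk, Option.mem_def, Option.some.injEq] at ha
          exact ha ▸ Finset.mem_image_of_mem _ hk
        · simp [t, if_neg hk] at ha
      · push Not at hs
        obtain ⟨k, hk⟩ := hs
        exact ⟨k, if_neg hk⟩

/-- The inverse of a finite partial isomorphism. -/
def FinPartialIso.inv (S : FinPartialIso n r) : FinPartialIso n r :=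
  ⟨S.1.map (Equiv.prodComm ℕ ℕ).toEmbedding, by
    have h : ∀ p : S.1.map (Equiv.prodComm ℕ ℕ).toEmbedding, p.1.swap ∈ S.1 := by
      rintro ⟨p, hp⟩
      obtain ⟨q, hq, rfl⟩ := Finset.mem_map.1 hp
      exact hq
    exact S.2.symm.comp fun p => ⟨p.1.swap, h p⟩⟩

theorem FinPartialIso.mem_inv {S : FinPartialIso n r} {a b : ℕ} :
    (a, b) ∈ S.inv.1 ↔ (b, a) ∈ S.1 := by
  simp [FinPartialIso.inv]

theorem FinPartialIso.exists_back (S : FinPartialIso n r) (m : ℕ) :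
    ∃ S' : FinPartialIso n r, S ≤ S' ∧ ∃ a, (a, m) ∈ S'.1 := by
  obtain ⟨S', hle, b, hb⟩ := S.inv.exists_forth m
  refine ⟨S'.inv, fun p hp => ?_, b, mem_inv.2 hb⟩
  exact mem_inv.2 (hle (mem_inv.2 (by simpa using hp)))

/-- The generic coloring is homogeneous, by a back-and-forth argument. -/
theorem exists_perm_of_sameAtomic {ι : Type*} [Finite ι] {x y : ι → ℕ}
    (h : SameAtomic (natColor n r) (natColor n r) x y) :
    ∃ σ : Equiv.Perm ℕ, (∀ t : Fin n → ℕ, natColor n r (fun k => σ (t k)) = natColor n r t) ∧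
      ∀ i, σ (x i) = y i := by
  classical
  have := Fintype.ofFinite ι
  have hS₀ : ∀ p : Finset.univ.image (fun i => (x i, y i)), ∃ i, (x i, y i) = p.1 := fun p => by
    obtain ⟨i, -, hi⟩ := Finset.mem_image.1 p.2
    exact ⟨i, hi⟩
  choose g hg using hS₀
  let S₀ : FinPartialIso n r := ⟨Finset.univ.image fun i => (x i, y i), by
    have := h.comp g
    rwa [(funext fun p => congrArg Prod.fst (hg p) : (fun p => x (g p)) = fun p => p.1.1),
      (funext fun p => congrArg Prod.snd (hg p) : (fun p => y (g p)) = fun p => p.1.2)] at this⟩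
  let 𝒟 : ℕ ⊕ ℕ → Order.Cofinal (FinPartialIso n r) := Sum.elim
    (fun m => ⟨{S | ∃ b, (m, b) ∈ S.1}, fun S => by
      obtain ⟨S', h, h'⟩ := S.exists_forth m
      exact ⟨S', h', h⟩⟩)
    (fun m => ⟨{S | ∃ a, (a, m) ∈ S.1}, fun S => by
      obtain ⟨S', h, h'⟩ := S.exists_back m
      exact ⟨S', h', h⟩⟩)
  let Q := Order.sequenceOfCofinals S₀ 𝒟
  have hQ : Monotone Q := Order.sequenceOfCofinals.monotone S₀ 𝒟
  have hforth : ∀ a, ∃ b N, (a, b) ∈ (Q N).1 := fun a => by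
    obtain ⟨b, hb⟩ := Order.sequenceOfCofinals.encode_mem S₀ 𝒟 (.inl a)
    exact ⟨b, _, hb⟩
  have hback : ∀ b, ∃ a N, (a, b) ∈ (Q N).1 := fun b => by
    obtain ⟨a, ha⟩ := Order.sequenceOfCofinals.encode_mem S₀ 𝒟 (.inr b)
    exact ⟨a, _, ha⟩
  have huniq : ∀ a b a' b' N N', (a, b) ∈ (Q N).1 → (a', b') ∈ (Q N').1 → (a = a' ↔ b = b') :=
    fun a b a' b' N N' h h' => (Q (max N N')).2.1
      ⟨_, hQ (le_max_left N N') h⟩ ⟨_, hQ (le_max_right N N') h'⟩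
  choose f N hf using hforth
  choose f' N' hf' using hback
  refine ⟨⟨f, f', fun a => (huniq _ _ _ _ _ _ (hf' (f a)) (hf a)).2 rfl,
    fun b => (huniq _ _ _ _ _ _ (hf (f' b)) (hf' b)).1 rfl⟩, fun t => ?_, fun i => ?_⟩
  · let B := Finset.univ.sup fun k => N (t k)
    have hB : ∀ k, (t k, f (t k)) ∈ (Q B).1 := fun k =>
      hQ (Finset.le_sup (f := fun k => N (t k)) (Finset.mem_univ k)) (hf (t k))
    exact ((Q B).2.2 fun k => ⟨_, hB k⟩).symm
  · refine (huniq _ _ _ _ _ _ (hf (x i)) (?_ : (x i, y i) ∈ (Q 0).1)).1 rfl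
    exact Finset.mem_image_of_mem _ (Finset.mem_univ i)

/-- Every coloring of the tuples of a finite set is induced by the generic coloring. -/
theorem exists_natColor_comp_eq (hn : 0 < n) : ∀ (k : ℕ) (χ : (Fin n → Fin k) → Fin (r + 1)),
    ∃ x : Fin k → ℕ, Function.Injective x ∧
      ∀ s : Fin n → Fin k, natColor n r (fun i => x (s i)) = χ s
  | 0, χ => ⟨Fin.elim0, fun i => i.elim0, fun s => (s ⟨0, hn⟩).elim0⟩
  | k + 1, χ => by
    classical
    obtain ⟨x, hinj, hx⟩ := exists_natColor_comp_eq hn k fun s => χ fun i => (s i).castSucc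
    let φ : ℕ → Fin (k + 1) := fun a => if h : ∃ i, x i = a then h.choose.castSucc else Fin.last k
    have hφ : ∀ i, φ (x i) = i.castSucc := by
      intro i
      have h : ∃ j, x j = x i := ⟨i, rfl⟩
      simp only [φ, dif_pos h, hinj h.choose_spec]
    obtain ⟨m, hm, hcol⟩ := exists_natColor_eq n r (Finset.univ.image x)
      (fun t => χ fun i => (t i).elim (Fin.last k) φ)
    have hm' : ∀ i, x i < m := fun i => hm _ (Finset.mem_image_of_mem _ (Finset.mem_univ i))
    refine ⟨Fin.snoc (α := fun _ => ℕ) x m, ?_, fun s => ?_⟩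
    · exact Fin.snoc_injective_iff.2 ⟨hinj, fun ⟨i, hi⟩ => (hm' i).ne hi⟩
    · let t : Fin n → Option ℕ := fun i =>
        Fin.lastCases (motive := fun _ => Option ℕ) none (fun j => some (x j)) (s i)
      have h₁ : (fun i => Fin.snoc (α := fun _ => ℕ) x m (s i)) = fun i => (t i).getD m := by
        funext i
        simp only [t]
        refine Fin.lastCases ?_ (fun j => ?_) (s i) <;> simp
      have h₂ : (fun i => (t i).elim (Fin.last k) φ) = s := by
        funext i
        simp only [t]
        refine Fin.lastCases ?_ (fun j => ?_) (s i) <;> simp [hφ]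
      by_cases hs : ∃ i, t i = none
      · rw [h₁, hcol t ?_ hs, h₂]
        intro i
        simp only [t]
        refine Fin.lastCases ?_ (fun j => ?_) (s i) <;> simp
      · have hs' : ∀ i, ∃ j : Fin k, j.castSucc = s i := by
          intro i
          refine Fin.exists_castSucc_eq.2 fun hi => hs ⟨i, ?_⟩
          simp [t, hi]
        choose s' hs' using hs'
        rw [← funext hs', ← hx s']
        simp only [Fin.snoc_castSucc]

end GenericModel

/-! ### Saturated homogeneous models of the generic coloring -/

namespace GenericModel

open Filter

variable (n r : ℕ)

/-- The automorphisms of the generic coloring of `ℕ`. -/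
def NatAut : Type :=
  {σ : Equiv.Perm ℕ // ∀ t : Fin n → ℕ, natColor n r (fun k => σ (t k)) = natColor n r t}

/-- The values of names: a name stands both for a number and for an automorphism. -/
abbrev Val : Type := ℕ × NatAut n r

instance : Nonempty (Val n r) := ⟨(0, ⟨Equiv.refl ℕ, fun _ => rfl⟩)⟩

variable {n r} {X : Type x} (U : Ultrafilter (X → Val n r))

/-- Names which stand for the same number modulo `U`. -/
def nameSetoid : Setoid X where
  r x y := ∀ᶠ v : X → Val n r in U, (v x).1 = (v y).1
  iseqv :=
    { refl := fun _ => Eventually.of_forall fun _ => rfl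
      symm := fun h => h.mono fun _ h => h.symm
      trans := fun h h' => (h.and h').mono fun _ h => h.1.trans h.2 }

/-- The model given by `U`: the names modulo equality of the numbers they stand for. -/
def Model : Type x := Quotient (nameSetoid U)

/-- The element named by `x`. -/
def toModel (x : X) : Model U := Quotient.mk (nameSetoid U) x

variable {U}

/-- A name of an element. -/
noncomputable def Model.name (m : Model U) : X := Quotient.out m

theorem toModel_name (m : Model U) : toModel U m.name = m := Quotient.out_eq m

theorem toModel_eq_iff {x y : X} :
    toModel U x = toModel U y ↔ ∀ᶠ v : X → Val n r in U, (v x).1 = (v y).1 :=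
  ⟨fun h => Quotient.exact h, fun h => Quotient.sound (s := nameSetoid U) h⟩

theorem exists_eventually_color_eq (t : Fin n → X) :
    ∃ c, ∀ᶠ v : X → Val n r in U, natColor n r (fun k => (v (t k)).1) = c := by
  obtain ⟨c, hc⟩ := Ultrafilter.eq_pure_of_finite
    (U.map fun v : X → Val n r => natColor n r fun k => (v (t k)).1)
  refine ⟨c, ?_⟩
  have h : {c} ∈ U.map fun v : X → Val n r => natColor n r fun k => (v (t k)).1 := by
    rw [hc]
    exact Ultrafilter.mem_pure.2 rfl
  exact h

/-- The coloring of the model given by `U`. -/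
noncomputable def modelColor (t : Fin n → Model U) : Fin (r + 1) :=
  (exists_eventually_color_eq (U := U) fun k => (t k).name).choose

/-- Łoś's theorem for atomic formulas. -/
theorem eventually_sameAtomic {ι : Type*} [Finite ι] (x : ι → X) :
    ∀ᶠ v : X → Val n r in U, SameAtomic (natColor n r) modelColor
      (fun i => (v (x i)).1) (fun i => toModel U (x i)) := by
  refine Eventually.and ?_ ?_
  · refine eventually_all.2 fun i => eventually_all.2 fun j => ?_
    by_cases h : toModel U (x i) = toModel U (x j)
    · simpa [h] using toModel_eq_iff.1 h
    · simp only [h, iff_false]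
      exact Ultrafilter.eventually_not.2 fun h' => h (toModel_eq_iff.2 h')
  · refine eventually_all.2 fun s => ?_
    have h₁ := (exists_eventually_color_eq (U := U)
      fun k => (toModel U (x (s k))).name).choose_spec
    have h₂ : ∀ᶠ v : X → Val n r in U, ∀ k, (v (toModel U (x (s k))).name).1 = (v (x (s k))).1 :=
      eventually_all.2 fun k => toModel_eq_iff.1 (toModel_name _)
    filter_upwards [h₁, h₂] with v hv₁ hv₂
    rw [← funext hv₂]
    exact hv₁

variable {K : Type w}

/-- Every finitely satisfiable set of conditions with parameters indexed by `K` is realized. -/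
def IsSaturatedUltrafilter (U : Ultrafilter (X → Val n r)) (K : Type w) : Prop :=
  ∀ (Γ : Set ((K → Val n r) → Val n r → Prop)) (p : K → X),
    IsFinSat U Γ p → ∃ c, ∀ C ∈ Γ, ∀ᶠ v : X → Val n r in U, C (fun k => v (p k)) (v c)

/-- The numbers have constant names. -/
theorem IsSaturatedUltrafilter.exists_name_natCast [Nonempty X] (hU : IsSaturatedUltrafilter U K)
    (a : ℕ) : ∃ x, ∀ᶠ v : X → Val n r in U, (v x).1 = a := by
  obtain ⟨x, hx⟩ := hU {fun _ y => y.1 = a} (fun _ => Classical.arbitrary X) (by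
    refine fun Γ₀ hΓ₀ _ => Eventually.of_forall fun v => ?_
    refine ⟨(a, (v (Classical.arbitrary X)).2), fun C hC => ?_⟩
    rw [Set.mem_singleton_iff.1 (hΓ₀ hC)])
  exact ⟨x, hx _ rfl⟩

/-- The numbers are (up to isomorphism) contained in the model, so that it realizes all colorings
of finite sets. -/
theorem IsSaturatedUltrafilter.exists_modelColor_comp_eq [Nonempty X]
    (hU : IsSaturatedUltrafilter U K) (hn : 0 < n) (k : ℕ) (χ : (Fin n → Fin k) → Fin (r + 1)) :
    ∃ x : Fin k → Model U, ∀ s : Fin n → Fin k, modelColor (fun i => x (s i)) = χ s := by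
  obtain ⟨a, -, ha⟩ := exists_natColor_comp_eq hn k χ
  choose x hx using fun i => hU.exists_name_natCast (a i)
  refine ⟨fun i => toModel U (x i), fun s => ?_⟩
  obtain ⟨v, hv, hv'⟩ := ((eventually_sameAtomic x).and (eventually_all.2 hx)).exists
  rw [← ha s, ← hv.2 s, funext fun i => hv' (s i)]

/-- The action on names of the automorphisms named by names; `f` is evaluation of an automorphism or
of its inverse. -/
theorem IsSaturatedUltrafilter.exists_name_apply [Nonempty K]
    (hU : IsSaturatedUltrafilter U (K ⊕ K)) (f : NatAut n r → ℕ → ℕ) (c x : X) :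
    ∃ y, ∀ᶠ v : X → Val n r in U, (v y).1 = f (v c).2 (v x).1 := by
  let k₀ := Classical.arbitrary K
  obtain ⟨y, hy⟩ := hU {fun z y => y.1 = f (z (.inl k₀)).2 (z (.inr k₀)).1}
    (Sum.elim (fun _ => c) fun _ => x) (by
      refine fun Γ₀ hΓ₀ _ => Eventually.of_forall fun v => ?_
      refine ⟨(f (v c).2 (v x).1, (v c).2), fun C hC => ?_⟩
      rw [Set.mem_singleton_iff.1 (hΓ₀ hC)]
      rfl)
  exact ⟨y, hy _ rfl⟩

/-- The model is homogeneous for families indexed by `K`: the required automorphism is given by a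
name, since its finite approximations exist in the generic coloring. -/
theorem IsSaturatedUltrafilter.exists_equiv [Nonempty K]
    (hU : IsSaturatedUltrafilter U (K ⊕ K)) {p q : K → Model U}
    (hpq : SameAtomic modelColor modelColor p q) :
    ∃ σ : Model U ≃ Model U, (∀ t, modelColor (fun k => σ (t k)) = modelColor t) ∧
      ∀ k, σ (p k) = q k := by
  obtain ⟨c, hc⟩ := hU
    (Set.range fun k z y => y.2.1 (z (.inl k)).1 = (z (.inr k)).1)
    (Sum.elim (fun k => (p k).name) fun k => (q k).name) (by
      intro Γ₀ hΓ₀ hfin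
      choose k hk using fun C : Γ₀ => hΓ₀ C.2
      have := hfin.to_subtype
      filter_upwards [eventually_sameAtomic fun C => (p (k C)).name,
        eventually_sameAtomic fun C => (q (k C)).name] with v h₁ h₂
      simp only [toModel_name] at h₁ h₂
      obtain ⟨σ, hσ, hσ'⟩ := exists_perm_of_sameAtomic ((h₁.trans (hpq.comp k)).trans h₂.symm)
      refine ⟨(0, ⟨σ, hσ⟩), fun C hC => ?_⟩
      have hCk : _ = C := hk ⟨C, hC⟩
      rw [← hCk]
      exact hσ' ⟨C, hC⟩)
  choose f hf using hU.exists_name_apply (fun σ => σ.1) c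
  choose f' hf' using hU.exists_name_apply (fun σ => σ.1.symm) c
  let σ : Model U → Model U := fun m => toModel U (f m.name)
  let σ' : Model U → Model U := fun m => toModel U (f' m.name)
  have hσ : ∀ x y, (∀ᶠ v : X → Val n r in U, (v y).1 = (v c).2.1 (v x).1) →
      σ (toModel U x) = toModel U y := by
    intro x y h
    refine toModel_eq_iff.2 ?_
    filter_upwards [h, hf (toModel U x).name, toModel_eq_iff.1 (toModel_name (toModel U x))] with
      v h₁ h₂ h₃
    rw [h₁, h₂, h₃]
  have hσ' : ∀ x y, (∀ᶠ v : X → Val n r in U, (v x).1 = (v c).2.1 (v y).1) →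
      σ' (toModel U x) = toModel U y := by
    intro x y h
    refine toModel_eq_iff.2 ?_
    filter_upwards [h, hf' (toModel U x).name, toModel_eq_iff.1 (toModel_name (toModel U x))] with
      v h₁ h₂ h₃
    rw [h₂, h₃, h₁, Equiv.symm_apply_apply]
  refine ⟨⟨σ, σ', fun m => ?_, fun m => ?_⟩, fun t => ?_, fun k => ?_⟩
  · conv_rhs => rw [← toModel_name m]
    exact hσ' _ _ (hf m.name)
  · conv_rhs => rw [← toModel_name m]
    refine hσ _ _ ((hf' m.name).mono fun v hv => ?_)
    rw [hv, Equiv.apply_symm_apply]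
  · obtain ⟨v, h₁, h₂, h₃⟩ := ((eventually_sameAtomic fun k => (t k).name).and
      ((eventually_sameAtomic fun k => f (t k).name).and
        (eventually_all.2 fun k => hf (t k).name))).exists
    have e₁ := h₁.2 id
    have e₂ := h₂.2 id
    simp only [id, toModel_name] at e₁ e₂
    refine e₂.symm.trans (Eq.trans ?_ e₁)
    rw [funext h₃]
    exact (v c).2.2 _
  · have := hc _ ⟨k, rfl⟩
    change σ (p k) = q k
    rw [← toModel_name (p k), ← toModel_name (q k)]
    exact hσ _ _ (this.mono fun v hv => hv.symm)

/-- The model realizes every finitely satisfiable family of conditions, each of which is a union of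
atomic types over finitely many of the parameters `p`. -/
theorem IsSaturatedUltrafilter.exists_forall_snoc_mem
    (hU : IsSaturatedUltrafilter U (K ⊕ K)) (p : K → Model U) {J : Type*} (k : J → ℕ)
    (s : ∀ j, Fin (k j) → K) (E : ∀ j, Set (Fin (k j + 1) → Model U))
    (hE : ∀ j, ∀ e ∈ E j, ∀ e', SameAtomic modelColor modelColor e e' → e' ∈ E j)
    (hfs : ∀ T : Set J, T.Finite → ∃ m : Model U, ∀ j ∈ T,
      Fin.snoc (α := fun _ => Model U) (fun i => p (s j i)) m ∈ E j) :
    ∃ m : Model U, ∀ j, Fin.snoc (α := fun _ => Model U) (fun i => p (s j i)) m ∈ E j := by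
  -- Łoś's theorem for the tuple of the parameters of the `j`-th condition and one more name.
  have los : ∀ j (x : X), ∀ᶠ v : X → Val n r in U, SameAtomic (natColor n r) modelColor
      (Fin.snoc (α := fun _ => ℕ) (fun i => (v (p (s j i)).name).1) (v x).1)
      (Fin.snoc (α := fun _ => Model U) (fun i => p (s j i)) (toModel U x)) := by
    intro j x
    filter_upwards [eventually_sameAtomic
      (Fin.snoc (α := fun _ => X) (fun i => (p (s j i)).name) x)] with v hv
    convert hv using 1
    · funext i
      refine Fin.lastCases ?_ (fun i => ?_) i <;> simp
    · funext i
      refine Fin.lastCases ?_ (fun i => ?_) i <;> simp [toModel_name]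
  obtain ⟨c, hc⟩ := hU
    (Set.range fun j z y => ∃ e ∈ E j, SameAtomic (natColor n r) modelColor
      (Fin.snoc (α := fun _ => ℕ) (fun i => (z (.inl (s j i))).1) y.1) e)
    (Sum.elim (fun k => (p k).name) fun k => (p k).name) (by
      intro Γ₀ hΓ₀ hfin
      choose j hj using fun C : Γ₀ => hΓ₀ C.2
      have := hfin.to_subtype
      obtain ⟨m, hm⟩ := hfs (Set.range j) (Set.finite_range j)
      filter_upwards [eventually_all.2 fun C => los (j C) m.name] with v hv
      refine ⟨v m.name, fun C hC => ?_⟩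
      have hCj : _ = C := hj ⟨C, hC⟩
      rw [← hCj]
      refine ⟨_, hm _ ⟨⟨C, hC⟩, rfl⟩, ?_⟩
      have := hv ⟨C, hC⟩
      rwa [toModel_name] at this)
  refine ⟨toModel U c, fun j => ?_⟩
  obtain ⟨v, ⟨e, he, he'⟩, hv⟩ := ((hc _ ⟨j, rfl⟩).and (los j c)).exists
  exact hE j e he _ (he'.symm.trans hv)

end GenericModel

/-! ### A monster model of the generic coloring -/

namespace MetricSignature

section Automorphism

variable {S : MetricSignature.{s, t}} {M : Type x} [MetricSpace M] [S.Structure M]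

theorem IsAutomorphism.term_eval {σ : M ≃ M} (hσ : S.IsAutomorphism σ) {n : ℕ} (t : S.Term n)
    (a : Fin n → M) : t.eval (fun i => σ (a i)) = σ (t.eval a) := by
  induction t with
  | var i => rfl
  | func f ts ih => simp only [Term.eval, ih, hσ.map_fun]

theorem IsAutomorphism.formula_eval {σ : M ≃ M} (hσ : S.IsAutomorphism σ) {n : ℕ}
    (φ : S.Formula n) : ∀ a : Fin n → M, φ.eval (fun i => σ (a i)) = φ.eval a := by
  have hsnoc : ∀ (k : ℕ) (a : Fin k → M) (m : M),
      Fin.snoc (α := fun _ => M) (fun i => σ (a i)) (σ m) =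
        fun i => σ (Fin.snoc (α := fun _ => M) a m i) := by
    intro k a m
    funext i
    refine Fin.lastCases ?_ (fun i => ?_) i <;> simp
  induction φ with
  | dist t₁ t₂ => intro a; simp only [Formula.eval, hσ.term_eval, hσ.dist_eq]
  | pred P ts => intro a; simp only [Formula.eval, hσ.term_eval, hσ.map_pred]
  | conn c φs ih => intro a; simp only [Formula.eval, ih]
  | sup φ ih =>
    intro a
    simp only [Formula.eval]
    rw [← σ.iSup_comp]
    simp only [hsnoc, ih]
  | inf φ ih =>
    intro a
    simp only [Formula.eval]
    rw [← σ.iInf_comp]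
    simp only [hsnoc, ih]

end Automorphism

end MetricSignature

namespace GenericModel

open MetricSignature

/-- The only predicate symbol, of arity `n`. -/
inductive ColorPred (n : ℕ) : ℕ → Type t
  | color : ColorPred n n

/-- The signature with a single predicate symbol, of arity `n`. Since it is meant for discrete
structures, the moduli of uniform continuity are constantly `1`. -/
def colorSignature (n : ℕ) : MetricSignature.{s, t} where
  Functions _ := PEmpty.{s + 1}
  Predicates := ColorPred n
  funModulus _ _ _ := ⟨1, Set.mem_Ioi.2 one_pos⟩
  predModulus _ _ _ := ⟨1, Set.mem_Ioi.2 one_pos⟩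

/-- The truth value `c / (r + 1)` which represents the color `c`. -/
noncomputable def colorValue {r : ℕ} (c : Fin (r + 1)) : unitInterval :=
  ⟨(c : ℝ) / (r + 1), by positivity, (div_le_one (by positivity)).2 (by exact_mod_cast c.2.le)⟩

/-- Distinct colors have truth values at distance at least `1 / (r + 1)`. -/
theorem eq_of_abs_colorValue_sub_lt {r : ℕ} {c d : Fin (r + 1)}
    (h : |(colorValue c : ℝ) - colorValue d| < 1 / (r + 1)) : c = d := by
  have hr : (0 : ℝ) < r + 1 := by positivity
  simp only [colorValue] at h
  rw [← sub_div, abs_div, abs_of_pos hr, div_lt_div_iff_of_pos_right hr] at h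
  have h' : |((c : ℕ) : ℤ) - (d : ℕ)| < 1 := by exact_mod_cast h
  have := Int.abs_lt_one_iff.1 h'
  exact Fin.ext (by omega)

theorem colorValue_injective {r : ℕ} : Function.Injective (colorValue (r := r)) := by
  intro c d h
  refine eq_of_abs_colorValue_sub_lt ?_
  rw [h, sub_self, abs_zero]
  positivity

/-- The formula for the color of the tuple of variables given by `s`. -/
def colorFormula {n m : ℕ} (s : Fin n → Fin m) : (colorSignature.{s, t} n).Formula m :=
  Formula.pred (S := colorSignature.{s, t} n) (k := n) (ColorPred.color : ColorPred.{t} n n) fun i => .var (s i)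

open Classical in
/-- The discrete metric with distances `0` and `1`. -/
@[reducible]
noncomputable def discreteMetric (α : Type x) : MetricSpace α where
  dist a b := if a = b then 0 else 1
  dist_self a := if_pos rfl
  dist_comm a b := by simp only [eq_comm]
  dist_triangle a b c := by
    by_cases h : a = b
    · subst h; simp
    · by_cases h' : b = c
      · subst h'; simp
      · simp only [if_neg h, if_neg h']
        split_ifs <;> norm_num
  eq_of_dist_eq_zero {a b} h := by
    by_contra hab
    simp [hab] at h

variable {n r : ℕ} {X : Type x} {U : Ultrafilter (X → Val n r)}

noncomputable instance : MetricSpace (Model U) := discreteMetric _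

theorem dist_lt_one_iff {a b : Model U} : dist a b < 1 ↔ a = b := by
  classical
  change (if a = b then (0 : ℝ) else 1) < 1 ↔ a = b
  split_ifs with h <;> simp [h]

theorem dist_model_le_one (a b : Model U) : dist a b ≤ 1 := by
  classical
  change (if a = b then (0 : ℝ) else 1) ≤ 1
  split_ifs <;> norm_num

theorem dist_eq_dist_of_iff {a b c d : Model U} (h : a = b ↔ c = d) : dist a b = dist c d := by
  classical
  change (if a = b then (0 : ℝ) else 1) = if c = d then 0 else 1
  simp only [h]

/-- The truth value of the predicate symbol. -/
noncomputable def predValue : {k : ℕ} → ColorPred.{t} n k → (Fin k → Model U) → unitInterval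
  | _, .color, a => colorValue (modelColor a)

noncomputable instance [Nonempty X] : (colorSignature.{s, t} n).Structure (Model U) where
  nonempty := ⟨toModel U (Classical.arbitrary X)⟩
  complete := by
    refine Metric.complete_of_cauchySeq_tendsto fun f hf => ?_
    obtain ⟨N, hN⟩ := Metric.cauchySeq_iff'.1 hf 1 one_pos
    exact ⟨f N, tendsto_const_nhds.congr' ((Filter.eventually_ge_atTop N).mono
      fun k hk => (dist_lt_one_iff.1 (hN k hk)).symm)⟩
  dist_le_one := dist_model_le_one
  funMap f := PEmpty.elim f
  predMap P a := predValue P a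
  funMap_modulus f := PEmpty.elim f
  predMap_modulus P i ε a b c h := by
    rw [dist_lt_one_iff.1 h, dist_self]
    exact ε.2.le

theorem eval_colorFormula [Nonempty X] {m : ℕ} (s : Fin n → Fin m) (a : Fin m → Model U) :
    (colorFormula.{s, t} s).eval a = colorValue (modelColor fun i => a (s i)) :=
  rfl

theorem sameAtomic_of_sameType [Nonempty X] {ι : Type*} {p q : ι → Model U}
    (h : ∀ (k : ℕ) (s : Fin k → ι), (colorSignature.{s, t} n).SameType
      (fun i => p (s i)) (fun i => q (s i))) :
    SameAtomic modelColor modelColor p q := by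
  refine ⟨fun i j => ?_, fun s => ?_⟩
  · have := congrArg Subtype.val (h 2 ![i, j] (.dist (.var 0) (.var 1)))
    have hd : dist (p i) (p j) = dist (q i) (q j) := this
    rw [← dist_lt_one_iff, hd, dist_lt_one_iff]
  · exact colorValue_injective (h n s (colorFormula id))

theorem isAutomorphism_of_modelColor [Nonempty X] {σ : Model U ≃ Model U}
    (hσ : ∀ t, modelColor (fun k => σ (t k)) = modelColor t) :
    (colorSignature.{s, t} n).IsAutomorphism σ where
  dist_eq a b := dist_eq_dist_of_iff σ.injective.eq_iff
  map_fun f := PEmpty.elim f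
  map_pred P a := by
    cases (P : ColorPred n _)
    exact congrArg colorValue (hσ a)

variable {K : Type x}

/-- The value of a formula only depends on the atomic type, by homogeneity. -/
theorem IsSaturatedUltrafilter.eval_eq [Nonempty X] [Infinite K]
    (hU : IsSaturatedUltrafilter U (K ⊕ K)) {k : ℕ} {e e' : Fin (k + 1) → Model U}
    (h : SameAtomic modelColor modelColor e e') (φ : (colorSignature.{s, t} n).Formula (k + 1)) :
    φ.eval e = φ.eval e' := by
  obtain ⟨g, hg⟩ : ∃ g : K → Fin (k + 1), Function.Surjective g :=
    ⟨_, Function.invFun_surjective (Fin.valEmbedding.trans (Infinite.natEmbedding K)).injective⟩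
  obtain ⟨σ, hσ, hσ'⟩ := hU.exists_equiv (h.comp g)
  rw [← (isAutomorphism_of_modelColor hσ).formula_eval φ e]
  refine congrArg _ (funext fun i => ?_)
  obtain ⟨x, rfl⟩ := hg i
  exact hσ' x

theorem IsSaturatedUltrafilter.isStronglyHomogeneous [Nonempty X]
    (hU : IsSaturatedUltrafilter U (K ⊕ K)) :
    IsStronglyHomogeneous (colorSignature.{s, t} n) (Model U) #K := by
  intro A hA f hf
  rcases isEmpty_or_nonempty A with hempty | hne
  · exact ⟨Equiv.refl _, isAutomorphism_of_modelColor fun _ => rfl, fun a => hempty.elim a⟩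
  · obtain ⟨g, hg⟩ : ∃ g : K → A, Function.Surjective g := by
      obtain ⟨i⟩ := Cardinal.le_def _ _ |>.1 hA.le
      exact ⟨_, Function.invFun_surjective i.injective⟩
    have : Nonempty K := hne.map (Function.surjInv hg)
    obtain ⟨σ, hσ, hσ'⟩ := hU.exists_equiv
      ((sameAtomic_of_sameType (p := fun a : A => (a : Model U)) (q := f) hf).comp g)
    refine ⟨σ, isAutomorphism_of_modelColor hσ, fun a => ?_⟩
    obtain ⟨k, rfl⟩ := hg a
    exact hσ' k

/-- A continuous condition with error `ε` holds on a union of atomic types, so that continuous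
saturation is an instance of saturation for atomic types. -/
theorem IsSaturatedUltrafilter.isSaturated [Nonempty X] [Infinite K]
    (hU : IsSaturatedUltrafilter U (K ⊕ K)) :
    IsSaturated (colorSignature.{s, t} n) (Model U) #K := by
  classical
  intro A hA Γ hΓ
  obtain ⟨g⟩ := Cardinal.le_def _ _ |>.1 hA.le
  let p : K → Model U := fun k =>
    if h : ∃ a, g a = k then h.choose else toModel U (Classical.arbitrary X)
  have hp : ∀ a, p (g a) = a := by
    intro a
    have h : ∃ b, g b = g a := ⟨a, rfl⟩
    simp only [p, dif_pos h, g.injective h.choose_spec]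
  have hsnoc : ∀ (c : (colorSignature.{s, t} n).Cond A) (m : Model U), c.eval m =
      c.formula.eval (Fin.snoc (α := fun _ => Model U) (fun i => p (g (c.params i))) m) := by
    intro c m
    simp only [hp]
    rfl
  obtain ⟨m, hm⟩ := hU.exists_forall_snoc_mem p (J := Γ × Set.Ioi (0 : ℝ)) (fun j => j.1.1.n)
    (fun j i => g (j.1.1.params i)) (fun j => {z | (j.1.1.formula.eval z : ℝ) ≤ j.2})
    (fun j e he e' hee' => by
      change (j.1.1.formula.eval e' : ℝ) ≤ j.2
      rwa [← hU.eval_eq hee'])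
    (fun T hT => by
      -- Finitely many positive real numbers have a positive lower bound.
      obtain ⟨ε, hε, hεT⟩ : ∃ ε : ℝ, 0 < ε ∧ ∀ j ∈ T, ε ≤ j.2 := by
        induction T, hT using Set.Finite.induction_on with
        | empty => exact ⟨1, one_pos, by simp⟩
        | @insert j _ _ _ ih =>
          obtain ⟨ε, hε, h⟩ := ih
          refine ⟨min ε j.2, lt_min hε j.2.2, ?_⟩
          rintro i (rfl | hi)
          · exact min_le_right _ _
          · exact (min_le_left _ _).trans (h i hi)
      obtain ⟨m, hm⟩ := hΓ ((fun j => j.1.1) '' T) (by rintro _ ⟨j, -, rfl⟩; exact j.1.2)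
        (hT.image _) ε hε
      refine ⟨m, fun j hj => ?_⟩
      have := hm _ ⟨j, hj, rfl⟩
      rw [hsnoc] at this
      exact this.trans (hεT j hj))
  refine ⟨m, fun c hc => Subtype.ext (le_antisymm (le_of_forall_pos_le_add fun ε hε => ?_)
    (c.eval m).2.1)⟩
  have := hm (⟨c, hc⟩, ⟨ε, hε⟩)
  rw [hsnoc]
  simpa using this

/-- There are strong limit cardinals above any given cardinal. -/
theorem exists_isStrongLimit_gt (μ : Cardinal.{x}) :
    ∃ κ : Cardinal.{x}, κ.IsStrongLimit ∧ μ < κ := by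
  refine ⟨ℶ_ (μ.ord + Ordinal.omega0), isStrongLimit_beth.2 ?_, ?_⟩
  · exact (Ordinal.isSuccLimit_add _ Ordinal.isSuccLimit_omega0).isSuccPrelimit
  · refine (le_beth_ord μ).trans_lt (beth_strictMono ?_)
    exact lt_add_of_pos_right _ Ordinal.omega0_pos

/-- There are monster models of arbitrary degree of saturation in which all finite colorings of
`n`-tuples are realized. -/
theorem exists_isMonster {n r : ℕ} (hn : 0 < n) (μ : Cardinal.{x})
    (hμ : Cardinal.lift.{x} #(Σ k : ℕ, (colorSignature.{s, t} n).Formula k) ≤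
      Cardinal.lift.{max s t} μ) :
    ∃ (M : Type x) (_ : MetricSpace M) (_ : (colorSignature.{s, t} n).Structure M)
      (κ : Cardinal.{x}), IsMonster M (∅ : Set (colorSignature.{s, t} n).Sentence) κ ∧ μ < κ ∧
      ∀ (k : ℕ) (χ : (Fin n → Fin k) → Fin (r + 1)), ∃ y : Fin k → M,
        ∀ s : Fin n → Fin k, (colorFormula.{s, t} id).eval (fun i => y (s i)) = colorValue (χ s) := by
  obtain ⟨κ, hκ, hμκ⟩ := exists_isStrongLimit_gt μ
  let K := κ.out
  have hK : #K = κ := mk_out κ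
  have : Infinite K := infinite_iff.2 (hK ▸ hκ.aleph0_le)
  obtain ⟨U, hU⟩ := exists_saturated_ultrafilter (Val n r) (K ⊕ K)
  have hU : IsSaturatedUltrafilter U (K ⊕ K) := hU
  have : Nonempty (Name (Val n r) (K ⊕ K)) := ⟨.base⟩
  refine ⟨Model U, inferInstance, inferInstance, κ, ⟨fun φ hφ => hφ.elim, hκ,
    hμ.trans_lt (lift_lt.2 hμκ), hK ▸ hU.isSaturated, hK ▸ hU.isStronglyHomogeneous⟩, hμκ,
    fun k χ => ?_⟩
  obtain ⟨y, hy⟩ := hU.exists_modelColor_comp_eq hn k χ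
  refine ⟨y, fun s => ?_⟩
  rw [eval_colorFormula, ← hy s]
  rfl

end GenericModel

/-! ### Indiscernibles yield the embedding Ramsey property -/

namespace FirstOrder.Language

open MetricSignature GenericModel

variable {L : FirstOrder.Language.{u, v}} {I : Type w} [L.Structure I]

/-- If no structure in the age witnesses the Ramsey property for `A` and `B`, then, by compactness,
there is a single coloring of the embeddings of `A` into `I` without homogeneous copies of `B`. -/
theorem exists_coloring_of_not_ramseyArrow (hI : L.IsLocallyFinite I) {A B : Type w}
    [L.Structure A] [L.Structure B] [Finite A] [Finite B] {r : ℕ}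
    (h : ∀ C ∈ L.age I, ¬ L.RamseyArrow C B A (r + 1)) :
    ∃ χ : (A ↪[L] I) → Fin (r + 1), ∀ f : B ↪[L] I, ∃ g g' : A ↪[L] B,
      χ (f.comp g) ≠ χ (f.comp g') := by
  classical
  have hloc : ∀ s : Set I, s.Finite → ∃ χ : (A ↪[L] I) → Fin (r + 1), ∀ f : B ↪[L] I,
      (∀ b, f b ∈ s) → ∃ g g' : A ↪[L] B, χ (f.comp g) ≠ χ (f.comp g') := by
    intro s hs
    let C := Substructure.closure L s
    have : Finite C := hI C (Substructure.fg_closure hs)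
    have hC := h _ (mem_age_of_finite C)
    simp only [RamseyArrow] at hC
    push Not at hC
    obtain ⟨χ, hχ⟩ := hC
    -- Embeddings whose range is not contained in `C` get an arbitrary color.
    let χ' : (A ↪[L] I) → Fin (r + 1) := fun e =>
      if he : ∃ e' : A ↪[L] C, C.subtype.comp e' = e then χ he.choose else 0
    have hχ' : ∀ e : A ↪[L] C, χ' (C.subtype.comp e) = χ e := by
      intro e
      have he : ∃ e' : A ↪[L] C, C.subtype.comp e' = C.subtype.comp e := ⟨e, rfl⟩
      have heq : he.choose = e := by
        ext x
        exact congrArg Subtype.val (C.subtype.injective (DFunLike.congr_fun he.choose_spec x))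
      simp only [χ', dif_pos he, heq]
    refine ⟨χ', fun f hf => ?_⟩
    let f' : B ↪[L] C := f.codRestrict C fun b => Substructure.subset_closure (hf b)
    have hf' : C.subtype.comp f' = f := Embedding.subtype_comp_codRestrict f C _
    obtain ⟨g, g', hgg'⟩ := hχ f'
    refine ⟨g, g', ?_⟩
    rw [← hf', Embedding.comp_assoc, Embedding.comp_assoc, hχ', hχ']
    exact hgg'
  choose χ hχ using fun s : {s : Set I // s.Finite} => hloc s.1 s.2
  -- The second summand keeps track of the elements of `I` which a finite set has to contain.
  let pts : Finset ((A ↪[L] I) ⊕ I) → {s : Set I // s.Finite} := fun T =>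
    ⟨{i : I | (Sum.inr i : (A ↪[L] I) ⊕ I) ∈ T},
      T.finite_toSet.preimage (f := Sum.inr) Sum.inr_injective.injOn⟩
  obtain ⟨ψ, hψ⟩ := Finset.rado_selection (α := (A ↪[L] I) ⊕ I) (β := fun _ => Fin (r + 1))
    fun T => Sum.elim (χ (pts T)) fun _ => 0
  refine ⟨fun e => ψ (.inl e), fun f => ?_⟩
  have hfin : (Set.range (fun g : A ↪[L] B => (.inl (f.comp g) : (A ↪[L] I) ⊕ I)) ∪
      Set.range fun b => .inr (f b)).Finite :=
    have : Finite (A ↪[L] B) := DFunLike.finite _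
    (Set.finite_range _).union (Set.finite_range _)
  obtain ⟨T, hT, hψT⟩ := hψ hfin.toFinset
  have hf : ∀ b, f b ∈ (pts T).1 := fun b =>
    hT (hfin.mem_toFinset.2 (Or.inr ⟨b, rfl⟩))
  obtain ⟨g, g', hgg'⟩ := hχ (pts T) f hf
  refine ⟨g, g', ?_⟩
  have hψχ : ∀ g : A ↪[L] B, ψ (.inl (f.comp g)) = χ (pts T) (f.comp g) := fun g =>
    hψT _ (hfin.mem_toFinset.2 (Or.inl ⟨g, rfl⟩))
  simpa only [hψχ] using hgg'

/-- In a saturated structure which realizes all finite colorings, every coloring of the `n`-tuples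
of a small set is realized. -/
theorem exists_eval_colorFormula_eq {n r : ℕ} {M : Type x} [MetricSpace M]
    [(colorSignature.{s, t} n).Structure M] {κ : Cardinal.{x}}
    (hsat : IsSaturated (colorSignature.{s, t} n) M κ) {I : Type w}
    (hI : Cardinal.lift.{x} #I < Cardinal.lift.{w} κ)
    (hfin : ∀ (k : ℕ) (χ : (Fin n → Fin k) → Fin (r + 1)), ∃ y : Fin k → M,
      ∀ s : Fin n → Fin k, (colorFormula.{s, t} id).eval (fun i => y (s i)) = colorValue (χ s))
    (χ : (Fin n → I) → Fin (r + 1)) :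
    ∃ a : I → M, ∀ t : Fin n → I,
      (colorFormula.{s, t} id).eval (fun i => a (t i)) = colorValue (χ t) := by
  classical
  let cond : (Fin n → I) → (colorSignature.{s, t} n).VarCond I := fun t =>
    .nearSet (k := 1) (fun _ => colorFormula.{s, t} id) t {fun _ => colorValue (χ t)}
  obtain ⟨a, ha⟩ := hsat.exists_realization hI (Set.range cond) (by
    intro Γ₀ hΓ₀ hfinite ε hε
    have hF : (⋃ c ∈ Γ₀, Set.range c.idx).Finite := hfinite.biUnion fun c _ => Set.finite_range _
    let F := hF.toFinset
    let e := F.equivFin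
    obtain ⟨y, hy⟩ := hfin F.card fun s => χ fun i => (e.symm (s i)).1
    have : Nonempty M := Structure.nonempty (S := colorSignature.{s, t} n)
    refine ⟨fun i => if h : i ∈ F then y (e ⟨i, h⟩) else Classical.arbitrary M, fun c hc => ?_⟩
    obtain ⟨t, rfl⟩ := hΓ₀ hc
    have ht : ∀ k, t k ∈ F := fun k => hF.mem_toFinset.2 (Set.mem_biUnion hc ⟨k, rfl⟩)
    rw [VarCond.eval_nearSet, infDistConn_eq_zero_of_mem]
    · exact hε.le
    · refine Set.mem_singleton_iff.2 (funext fun _ => ?_)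
      have hyt := hy fun k => e ⟨t k, ht k⟩
      simp only [_root_.Equiv.symm_apply_apply] at hyt
      rw [← hyt]
      exact congrArg _ (funext fun k => dif_pos (ht k)))
  refine ⟨a, fun t => ?_⟩
  have h := ha _ ⟨t, rfl⟩
  have h0 : Metric.infDist (fun _ : Fin 1 => (colorFormula.{s, t} id).eval fun k => a (t k))
      {fun _ : Fin 1 => colorValue (χ t)} ≤ 0 := (Set.projIcc_eq_left one_pos).1 h
  rw [Metric.infDist_singleton] at h0
  exact congrFun (dist_le_zero.1 h0) 0

/-- The continuous modeling property, applied in a monster model of the generic coloring, transfers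
the indiscernibility of a sequence `b` to a coloring of embeddings which `a` realizes. -/
theorem HasCMP.ramseyArrow (hI : L.IsLocallyFinite I) (hC : HasCMP.{s, t, u, v, w} L I)
    {A B : Type w} [L.Structure A] [L.Structure B] [Finite A] [Finite B] (hB : Nonempty (B ↪[L] I))
    (r : ℕ) : ∃ C ∈ L.age I, L.RamseyArrow C B A r := by
  classical
  by_contra! h
  have hBage : CategoryTheory.Bundled.of (c := L.Structure) B ∈ L.age I :=
    ⟨Structure.FG.of_finite (M := B), hB⟩
  have hBB := h _ hBage
  simp only [RamseyArrow] at hBB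
  push Not at hBB
  obtain ⟨χ₀, hχ₀⟩ := hBB
  obtain ⟨g₀, g₁, hg⟩ := hχ₀ (Embedding.refl L B)
  -- The enumeration `eA` turns embeddings of `A` into `n`-tuples.
  obtain ⟨n, ⟨eA⟩⟩ := Finite.exists_equiv_fin A
  obtain ⟨m, ⟨eB⟩⟩ := Finite.exists_equiv_fin B
  obtain ⟨ι⟩ := hB
  have hn : 0 < n := by
    -- The empty structure has only one embedding into `B`.
    rcases Nat.eq_zero_or_pos n with rfl | hn
    · refine (hg (congrArg χ₀ ?_)).elim
      ext x
      exact (eA x).elim0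
    · exact hn
  cases r with
  | zero => exact (χ₀ ((Embedding.refl L B).comp g₀)).elim0
  | succ r =>
  obtain ⟨χ, hχ⟩ := exists_coloring_of_not_ramseyArrow hI h
  obtain ⟨M, _, _, κ, hM, hκ, hfin⟩ := exists_isMonster.{s, t, max s t w} (r := r) hn
    (max (Cardinal.lift.{max s t} #I)
      (Cardinal.lift.{w} #(Σ k : ℕ, (colorSignature.{s, t} n).Formula k))) (by
      rw [← lift_lift.{w, max s t}]
      exact lift_le.2 (le_max_right _ _))
  have hIκ : Cardinal.lift.{max s t} #I < κ := (le_max_left _ _).trans_lt hκ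
  obtain ⟨a, ha⟩ := exists_eval_colorFormula_eq hM.isSaturated (I := I) (by
    rw [← lift_lift.{max s t, w}]
    exact lift_lt.2 hIκ) hfin fun t =>
      if he : ∃ e : A ↪[L] I, (fun q => e (eA.symm q)) = t then χ he.choose else 0
  have ha' : ∀ e : A ↪[L] I,
      (colorFormula.{s, t} id).eval (fun q => a (e (eA.symm q))) = colorValue (χ e) := by
    intro e
    have he : ∃ e' : A ↪[L] I, (fun q => e' (eA.symm q)) = fun q => e (eA.symm q) := ⟨e, rfl⟩
    have heq : he.choose = e := by
      ext x
      simpa using congrFun he.choose_spec (eA x)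
    rw [ha, dif_pos he, heq]
  obtain ⟨b, hb, hba⟩ := hC _ _ M κ hM hIκ a
  let Δ : Set ((colorSignature.{s, t} n).Formula m) :=
    Set.range fun g : A ↪[L] B => colorFormula.{s, t} fun q => eB (g (eA.symm q))
  have hΔ : Δ.Finite :=
    have : Finite (A ↪[L] B) := DFunLike.finite _
    Set.finite_range _
  -- The values of distinct colors are at least `1 / (r + 1)` apart, and only two errors occur.
  obtain ⟨i, hi, hiΔ⟩ := hba m Δ hΔ (fun k => ι (eB.symm k)) (1 / (r + 1) / 4) (by positivity)
  obtain ⟨f, hf⟩ := (((sameQFType_embedding ι fun k => eB.symm k).trans hi.symm)).exists_embedding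
    (by rw [eB.symm.surjective.range_eq, Substructure.closure_univ])
  obtain ⟨g, g', hgg'⟩ := hχ f
  refine hgg' (eq_of_abs_colorValue_sub_lt ?_)
  have key : ∀ g : A ↪[L] B, |((colorFormula.{s, t} id).eval
      (fun q => b ((ι.comp g) (eA.symm q))) : ℝ) - colorValue (χ (f.comp g))| ≤
      1 / (r + 1) / 4 := by
    intro g
    have := hiΔ _ ⟨g, rfl⟩
    rw [← ha' (f.comp g)]
    have e₁ : (fun q => b ((ι.comp g) (eA.symm q))) =
        fun q => b (ι (eB.symm (eB (g (eA.symm q))))) := by simp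
    have e₂ : (fun q => a ((f.comp g) (eA.symm q))) = fun q => a (i (eB (g (eA.symm q)))) := by
      funext q
      rw [← hf]
      exact (congrArg (fun z => a (f z)) (eB.symm_apply_apply _)).symm
    rw [e₁, e₂]
    exact this
  have hsame : (colorFormula.{s, t} id).eval (fun q => b ((ι.comp g) (eA.symm q))) =
      (colorFormula.{s, t} id).eval (fun q => b ((ι.comp g') (eA.symm q))) :=
    hb n _ _ ((sameQFType_embedding (ι.comp g) eA.symm).symm.trans
      (sameQFType_embedding (ι.comp g') eA.symm)) _
  have h₁ := abs_le.1 (key g)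
  have h₂ := abs_le.1 (key g')
  rw [← hsame] at h₂
  have hr : (0 : ℝ) < 1 / (r + 1) := by positivity
  rw [abs_lt]
  constructor <;> linarith [h₁.1, h₁.2, h₂.1, h₂.2]

end FirstOrder.Language

theorem mainTheorem1 (L : FirstOrder.Language.{u, v}) (I : Type w) [L.Structure I]
    [Infinite I] (hI : L.IsLocallyFinite I) :
    FirstOrder.Language.HasERP (L.age I) ↔
      FirstOrder.Language.HasCMP.{s, t, u, v, w} L I := by
  refine ⟨fun hR S T M _ _ κ hM hκ a => ?_, fun hC B hB A _ r => ?_⟩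
  · refine hR.exists_isIndiscernible hI hM.isSaturated ?_ a
    rw [← lift_lift.{max s t, w}]
    exact lift_lt.2 hκ
  · have := hI.finite_of_mem_age hB
    exact hC.ramseyArrow hI hB.2 r
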